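/- Consider a service system with infinitely many servers and advance reservation. Customers arrive according to a Poisson process of rate $\lambda>0$. Each customer has an integer reservation time $D$ and an integer service time $S$; a customer who arrives at time $t$ reserves one server for the time interval $[t+D,\,t+D+S]$. The pairs $(D,S)$ of the customers are i.i.d. and independent of the arrival process; $D$ and $S$ of the same customer may be dependent. The law of $(D,S)$ does not depend on $\lambda$; $S$ has probability mass function $f_S(s)=\kappa_s$ with support contained in $\{1,\dots,v\}$, and $D$ has probability mass function $f_D(d)=\gamma_d$ with support contained in $\{0,\dots,u\}$. Let $\rho=\sum_{s=1}^{v}s\,\kappa_s\,\lambda$ be the traffic intensity and let $i=\min\{d:\gamma_d>0\}$. For a capacity $C$ and integers $0\le d\le u$, $1\le s\le v$, let $P_d^s$ be the conditional virtual blocking probability of a customer with reservation time $d$ and service time $s$ who arrives at time $0$ when the system is in steady state: the probability that the maximum over $r\in[d,d+s]$ of the number of servers reserved for time $r$ by the customers who arrived before time $0$ is at least $C$. Then, as $\lambda\to\infty$ with $C=\rho$, for every $s\in\{1,\dots,v\}$, $$\lim_{\lambda\to\infty}P_i^s=\frac12,\qquad \lim_{\lambda\to\infty}P_d^s=0\quad\text{for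 every } d\in\{i+1,\dots,u\}.$$ -/

import Mathlib

open MeasureTheory ProbabilityTheory Filter Topology
open scoped ENNReal

noncomputable section

namespace AdvanceReservation

/-- A realization of the past of the system, seen by a customer arriving at time `0`.
Earlier customers are numbered backwards in time: customer `0` is the last one that arrived
before time `0`, customer `1` the one before, and so on.  The entry at `n` is
`(gap, (D, S))`: the time between the arrival of customer `n` and the next later arrival
(time `0` when `n = 0`), the reservation time and the service time of customer `n`. -/
abbrev Past : Type := ℕ → ℝ × (ℕ × ℕ)

/-- Law of the past in steady state.  Customers arrive according to a Poisson process of rate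
`lam` on `(-∞, 0)` (independent exponential gaps with rate `lam`), and their pairs
`(D, S)` are independent of the arrival process and i.i.d. with joint
probability mass function `p`; `D` and `S` of one customer may be dependent. -/
def pastLaw (p : PMF (ℕ × ℕ)) (lam : ℝ) : Measure Past :=
  Measure.infinitePi fun _ : ℕ => (expMeasure lam).prod p.toMeasure

/-- Arrival time (before time `0`) of customer `n`. -/
def arrivalTime (ω : Past) (n : ℕ) : ℝ := -∑ k ∈ Finset.range (n + 1), (ω k).1

/-- Reservation time of customer `n`. -/
def reservationTime (ω : Past) (n : ℕ) : ℕ := (ω n).2.1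

/-- Service time of customer `n`. -/
def serviceTime (ω : Past) (n : ℕ) : ℕ := (ω n).2.2

/-- The time interval `[t + D, t + D + S]` reserved by customer `n`, who arrived at time `t`. -/
def reservedInterval (ω : Past) (n : ℕ) : Set ℝ :=
  Set.Icc (arrivalTime ω n + reservationTime ω n)
    (arrivalTime ω n + reservationTime ω n + serviceTime ω n)

/-- In the system with infinitely many servers (every customer is admitted): the number of
servers that the customers who arrived before time `0` have reserved for time `r`. -/
def reservedCapacity (ω : Past) (r : ℝ) : ℕ∞ := {n : ℕ | r ∈ reservedInterval ω n}.encard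

/-- The event that a customer arriving at time `0` with request `[d, d + s]` is virtually blocked
at capacity `C`: the reserved capacity reaches `C` at some time of the requested interval,
that is, its maximum over this interval is at least `C`. -/
def virtuallyBlocked (C : ℝ) (d s : ℕ) : Set Past :=
  {ω | ∃ r ∈ Set.Icc (d : ℝ) ((d : ℝ) + (s : ℝ)),
    ENNReal.ofReal C ≤ (reservedCapacity ω r : ℝ≥0∞)}

/-- The conditional long-run virtual blocking probability `P_d^s`, given that the arriving
customer has reservation time `d` and service time `s` (this pair is independent of the past). -/
def virtualBlockingProb (p : PMF (ℕ × ℕ)) (lam C : ℝ) (d s : ℕ) : ℝ :=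
  (pastLaw p lam).real (virtuallyBlocked C d s)

/-- Marginal law of the reservation time. -/
def reservationPMF (p : PMF (ℕ × ℕ)) : PMF ℕ := p.map Prod.fst

/-- Marginal law of the service time. -/
def servicePMF (p : PMF (ℕ × ℕ)) : PMF ℕ := p.map Prod.snd

/-- Traffic intensity `ρ = ∑ s * κ_s * lam`, for service times in `[1, v]`. -/
def trafficIntensity (p : PMF (ℕ × ℕ)) (v : ℕ) (lam : ℝ) : ℝ :=
  ∑ s ∈ Finset.Icc 1 v, (s : ℝ) * (servicePMF p s).toReal * lam

end AdvanceReservation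

end

noncomputable section

namespace AdvanceReservation

/-! Let `N(r)` be the number of servers reserved for time `r` by the earlier customers. It counts
points of a marked Poisson process, so it is Poisson. At `r = i` every reservation time is at least
`i`, hence each request is seen with its full service length and the mean of `N(i)` is exactly `ρ =
λ E[S]`. For `r > i` the requests with `D = i` are cut off by the arrival epoch `0`. With `γ = P(D =
i)`, the mean drops by at least `λ γ min(r - i, 1)`.

For `d > i` the mean is therefore below `ρ` by at least `γ λ` throughout `[d, d + s]`. A Chernoff
bound on windows of length `1/λ` is exponentially small in `λ`, while only `O(λ)` windows are
needed, so the limit is `0`.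

For `d = i`, blocking contains `{N(i) ≥ ρ}`, whose probability tends to `1/2` by the normal
approximation. Conversely, the drift of `N(r) - N(i)` is negative of order `λ (r - i)`, and so is
its variance in absolute value. Tilting by a small constant makes the drift dominate, so a window
exceeds `N(i)` by `x` with probability at most `exp(3 - c x)`. Taking `x = λ^{1/4}` beats the `O(λ)`
windows and is still negligible against the standard deviation `√ρ`, so the upper bound `{N(i) ≥ ρ -
x}` also has limit `1/2`.

Both ingredients come from `integral_prod_mul_tailFactor`, which computes expectations of products
over the points: real exponentials give the Chernoff bounds, complex ones the characteristic
function. The window estimates are `measureReal_add_le_pointSum_meets_le` and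
`measureReal_le_pointSum_meets_le`; the normal limit is `tendsto_measureReal_sub_le`. -/

/-! ### Renewal structure of i.i.d. sequences -/

/-- The sequence with first term `q.1`, followed by the sequence `q.2`. -/
def consSeq {X : Type*} (q : X × (ℕ → X)) : ℕ → X
  | 0 => q.1
  | n + 1 => q.2 n

lemma measurable_consSeq {X : Type*} [MeasurableSpace X] :
    Measurable (consSeq : X × (ℕ → X) → ℕ → X) := by
  refine measurable_pi_iff.2 fun n => ?_
  cases n with
  | zero => exact measurable_fst
  | succ n => exact (measurable_pi_apply n).comp measurable_snd

/-- An i.i.d. sequence is a first entry followed by an independent copy of itself. This is the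
renewal property behind the induction over points; it is checked on cylinders. -/
lemma map_consSeq {X : Type*} [MeasurableSpace X] (ν : Measure X) [IsProbabilityMeasure ν] :
    (ν.prod (Measure.infinitePi fun _ : ℕ => ν)).map consSeq
      = Measure.infinitePi fun _ : ℕ => ν := by
  classical
  refine Measure.eq_infinitePi _ fun s t ht => ?_
  set s' : Finset ℕ := s.preimage Nat.succ Nat.succ_injective.injOn with hs'
  have hpre : consSeq ⁻¹' (Set.pi (s : Set ℕ) t)
      = (if 0 ∈ s then t 0 else Set.univ) ×ˢ Set.pi (s' : Set ℕ) (fun n => t (n + 1)) := by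
    ext ⟨z, w⟩
    simp only [Set.mem_preimage, Set.mem_pi, Set.mem_prod, SetLike.mem_coe]
    constructor
    · intro h
      refine ⟨?_, fun n hn => h (n + 1) (by simpa [hs'] using hn)⟩
      split_ifs with h0
      · exact h 0 h0
      · trivial
    · rintro ⟨h0, h1⟩ n hn
      cases n with
      | zero =>
        rw [if_pos hn] at h0
        exact h0
      | succ n => exact h1 n (by simpa [hs'] using hn)
  rw [Measure.map_apply measurable_consSeq (MeasurableSet.pi s.countable_toSet fun i _ => ht i),
    hpre, Measure.prod_prod, Measure.infinitePi_pi _ (fun i _ => ht (i + 1))]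
  have hs : ∏ n ∈ s', ν (t (n + 1)) = ∏ n ∈ s.erase 0, ν (t n) := by
    rw [← Finset.prod_image (f := fun n => ν (t n)) (g := Nat.succ) Nat.succ_injective.injOn]
    refine Finset.prod_congr ?_ fun _ _ => rfl
    ext n
    cases n <;> simp [hs']
  rw [hs]
  by_cases h0 : 0 ∈ s
  · rw [if_pos h0, Finset.mul_prod_erase s (fun n => ν (t n)) h0]
  · rw [if_neg h0, measure_univ, one_mul, Finset.erase_eq_of_notMem h0]

/-- Sum of the first `n` gaps: the distance from `0` to the arrival of the customer `n - 1`. -/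
def elapsed {M : Type*} (ω : ℕ → ℝ × M) (n : ℕ) : ℝ := ∑ k ∈ Finset.range n, (ω k).1

lemma elapsed_consSeq {M : Type*} (z : ℝ × M) (w : ℕ → ℝ × M) (n : ℕ) :
    elapsed (consSeq (z, w)) (n + 1) = z.1 + elapsed w n := by
  rw [elapsed, Finset.sum_range_succ', add_comm]; rfl

lemma measurable_elapsed {M : Type*} [MeasurableSpace M] (n : ℕ) :
    Measurable fun ω : ℕ → ℝ × M => elapsed ω n :=
  Finset.measurable_sum _ fun k _ => measurable_fst.comp (measurable_pi_apply k)

/-- Martingale argument: `H` is invariant under one step of the walk weighted by `ψ`, hence under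
`n` steps. The first gap is split off, and the remaining points form the same process started from
`t + z.1`, which is why `t` varies in the induction. -/
lemma integral_prod_mul_of_step {M : Type*} [MeasurableSpace M] {ν : Measure (ℝ × M)}
    [IsProbabilityMeasure ν] (hν : ∀ᵐ z ∂ν, 0 ≤ z.1)
    {ψ : ℝ × M → ℂ} (hψ : Measurable ψ) {B : ℝ} (hψB : ∀ z, ‖ψ z‖ ≤ B)
    {H : ℝ → ℂ} (hH : Measurable H) {C : ℝ} (hHC : ∀ t, ‖H t‖ ≤ C)
    (hstep : ∀ t, 0 ≤ t → ∫ z, ψ (t + z.1, z.2) * H (t + z.1) ∂ν = H t) (n : ℕ) :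
    ∀ t, 0 ≤ t → ∫ ω, (∏ k ∈ Finset.range n, ψ (t + elapsed ω (k + 1), (ω k).2))
      * H (t + elapsed ω n) ∂(Measure.infinitePi fun _ : ℕ => ν) = H t := by
  have hm : ∀ (n : ℕ) (t : ℝ), Measurable fun ω : ℕ → ℝ × M =>
      (∏ k ∈ Finset.range n, ψ (t + elapsed ω (k + 1), (ω k).2)) * H (t + elapsed ω n) := by
    intro n t
    refine Measurable.mul (Finset.measurable_prod _ fun k _ => hψ.comp ?_)
      (hH.comp (measurable_const.add (measurable_elapsed n)))
    exact (measurable_const.add (measurable_elapsed _)).prodMk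
      (measurable_snd.comp (measurable_pi_apply k))
  have hb : ∀ (n : ℕ) (t : ℝ) (ω : ℕ → ℝ × M),
      ‖(∏ k ∈ Finset.range n, ψ (t + elapsed ω (k + 1), (ω k).2)) * H (t + elapsed ω n)‖
        ≤ B ^ n * C := by
    intro n t ω
    rw [norm_mul, norm_prod]
    have h1 : ∏ k ∈ Finset.range n, ‖ψ (t + elapsed ω (k + 1), (ω k).2)‖ ≤ B ^ n := by
      simpa using Finset.prod_le_prod (s := Finset.range n)
        (f := fun k => ‖ψ (t + elapsed ω (k + 1), (ω k).2)‖) (g := fun _ => B)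
        (fun _ _ => norm_nonneg _) (fun _ _ => hψB _)
    exact mul_le_mul h1 (hHC _) (norm_nonneg _)
      ((Finset.prod_nonneg fun _ _ => norm_nonneg _).trans h1)
  induction n with
  | zero => intro t _; simp [elapsed]
  | succ n ih =>
    intro t ht
    have hsplit : ∀ q : (ℝ × M) × (ℕ → ℝ × M),
        (∏ k ∈ Finset.range (n + 1), ψ (t + elapsed (consSeq q) (k + 1), (consSeq q k).2))
          * H (t + elapsed (consSeq q) (n + 1))
        = ψ (t + q.1.1, q.1.2) *
          ((∏ k ∈ Finset.range n, ψ (t + q.1.1 + elapsed q.2 (k + 1), (q.2 k).2))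
            * H (t + q.1.1 + elapsed q.2 n)) := by
      rintro ⟨z, w⟩
      rw [Finset.prod_range_succ', mul_comm (Finset.prod _ _), mul_assoc]
      simp only [elapsed_consSeq, ← add_assoc]
      simp [elapsed, consSeq]
    rw [← map_consSeq ν, integral_map measurable_consSeq.aemeasurable
      (hm (n + 1) t).aestronglyMeasurable, integral_prod]
    · rw [← hstep t ht]
      refine integral_congr_ae ?_
      filter_upwards [hν] with z hz
      simp only [hsplit]
      rw [integral_const_mul, ih (t + z.1) (by positivity)]
    · exact Integrable.of_bound ((hm (n + 1) t).comp measurable_consSeq).aestronglyMeasurable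
        (B ^ (n + 1) * C) (Eventually.of_forall fun q => hb (n + 1) t _)

/-! ### Exponential gaps and the renewal equation -/

lemma integral_expMeasure {lam : ℝ} (hlam : 0 < lam) (f : ℝ → ℂ) :
    ∫ x, f x ∂(expMeasure lam)
      = ∫ x in Set.Ioi 0, (lam * Real.exp (-(lam * x)) : ℝ) • f x := by
  have h1 : expMeasure lam = volume.withDensity (exponentialPDF lam) := rfl
  have hm : Measurable (exponentialPDF lam) :=
    (measurable_exponentialPDFReal lam).ennreal_ofReal
  rw [h1, integral_withDensity_eq_integral_toReal_smul hm
    (Eventually.of_forall fun x => ENNReal.ofReal_lt_top),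
    ← integral_Ici_eq_integral_Ioi, ← integral_indicator measurableSet_Ici]
  congr 1
  ext x
  by_cases hx : 0 ≤ x
  · rw [Set.indicator_of_mem (Set.mem_Ici.2 hx), exponentialPDF_of_nonneg hx,
      ENNReal.toReal_ofReal (by positivity)]
  · rw [Set.indicator_of_notMem (by simpa using hx), exponentialPDF_of_neg (not_le.1 hx)]
    simp

lemma ae_expMeasure_nonneg (lam : ℝ) : ∀ᵐ x ∂(expMeasure lam), 0 ≤ x := by
  have h1 : expMeasure lam = volume.withDensity (exponentialPDF lam) := rfl
  have hm : Measurable (exponentialPDF lam) :=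
    (measurable_exponentialPDFReal lam).ennreal_ofReal
  rw [h1, ae_withDensity_iff hm]
  refine Eventually.of_forall fun x hx => ?_
  by_contra h
  exact hx (exponentialPDF_of_neg (not_le.1 h))

lemma norm_integral_sub_one_le {φ : ℝ → ℂ} {B L : ℝ} (hL : 0 ≤ L) (hB : ∀ y, ‖φ y‖ ≤ B)
    (hφL : ∀ y, L ≤ y → φ y = 1) {t : ℝ} (ht : 0 ≤ t) :
    ‖∫ y in t..L, (φ y - 1)‖ ≤ (B + 1) * L := by
  have hB0 : 0 ≤ B := (norm_nonneg _).trans (hB 0)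
  rcases le_total t L with h | h
  · refine (intervalIntegral.norm_integral_le_of_norm_le_const (C := B + 1) fun y _ => ?_).trans ?_
    · exact (norm_sub_le _ _).trans (by simpa using hB y)
    · rw [abs_of_nonneg (by linarith)]
      exact mul_le_mul_of_nonneg_left (by linarith) (by linarith)
  · rw [intervalIntegral.integral_congr (g := fun _ => 0)]
    · simp only [intervalIntegral.integral_zero, norm_zero]
      positivity
    · intro y hy
      rw [Set.uIcc_of_ge h] at hy
      simp [hφL y hy.1]

/-- Says that `t ↦ exp (lam ∫_t^L (φ - 1))` is invariant under one exponential step weighted by `φ`.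
The integrand is an exact derivative wherever `φ` is continuous, and the boundary term at infinity
vanishes because the exponent stays bounded. -/
lemma renewal_identity {lam : ℝ} (hlam : 0 < lam) {φ : ℝ → ℂ} (hφ : Measurable φ) {B L : ℝ}
    (hL : 0 ≤ L) (hB : ∀ y, ‖φ y‖ ≤ B) (hφL : ∀ y, L ≤ y → φ y = 1)
    {K : Set ℝ} (hK : K.Countable) (hc : ∀ y, y ∉ K → ContinuousAt φ y)
    {t : ℝ} (ht : 0 ≤ t) :
    ∫ x in Set.Ioi 0, (lam * Real.exp (-(lam * x)) : ℝ) •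
        (φ (t + x) * Complex.exp (lam * ∫ y in (t + x)..L, (φ y - 1)))
      = Complex.exp (lam * ∫ y in t..L, (φ y - 1)) := by
  set I : ℝ → ℂ := fun s => ∫ y in s..L, (φ y - 1) with hI
  have hB0 : 0 ≤ B := (norm_nonneg _).trans (hB 0)
  have hii : ∀ a b, IntervalIntegrable (fun y => φ y - 1) volume a b := by
    intro a b
    refine IntervalIntegrable.sub ?_ intervalIntegrable_const
    refine (intervalIntegrable_const (c := B)).mono_fun hφ.aestronglyMeasurable ?_
    exact Eventually.of_forall fun y => (hB y).trans (le_abs_self B)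
  have hIcont : Continuous I := by
    have h : Continuous fun s => ∫ y in L..s, (φ y - 1) :=
      intervalIntegral.continuous_primitive hii L
    have h2 : I = fun s => -∫ y in L..s, (φ y - 1) := by
      ext s; exact intervalIntegral.integral_symm L s
    rw [h2]; exact h.neg
  have hIderiv : ∀ s, s ∉ K → HasDerivAt I (-(φ s - 1)) s := by
    intro s hs
    exact intervalIntegral.integral_hasDerivAt_left (hii s L)
      ((hφ.sub_const 1).stronglyMeasurable.stronglyMeasurableAtFilter)
      ((hc s hs).sub continuousAt_const)
  have hIb : ∀ s, 0 ≤ s → ‖I s‖ ≤ (B + 1) * L := fun s hs =>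
    norm_integral_sub_one_le hL hB hφL hs
  have hEb : ∀ s, 0 ≤ s → ‖Complex.exp (lam * I s)‖ ≤ Real.exp (lam * ((B + 1) * L)) := by
    intro s hs
    refine (Complex.norm_exp_le_exp_norm _).trans (Real.exp_le_exp.2 ?_)
    rw [norm_mul, Complex.norm_real, Real.norm_of_nonneg hlam.le]
    exact mul_le_mul_of_nonneg_left (hIb s hs) hlam.le
  -- The antiderivative of `f` off the shifted exceptional set: differentiating the second factor
  -- produces `-lam (φ - 1)`, whose constant part cancels the derivative of the first.
  set F : ℝ → ℂ := fun x => -(Real.exp (-(lam * x)) • Complex.exp (lam * I (t + x))) with hF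
  set f : ℝ → ℂ := fun x => (lam * Real.exp (-(lam * x)) : ℝ) •
        (φ (t + x) * Complex.exp (lam * I (t + x))) with hf
  have hfm : Measurable f := by
    have : Measurable fun x => φ (t + x) := hφ.comp (measurable_const.add measurable_id)
    have h2 : Continuous fun x => Complex.exp (lam * I (t + x)) := by fun_prop
    have h3 : Continuous fun x : ℝ => (lam * Real.exp (-(lam * x)) : ℝ) := by fun_prop
    exact h3.measurable.smul (this.mul h2.measurable)
  have hfint : IntegrableOn f (Set.Ioi 0) := by
    have h1 : IntegrableOn (fun x : ℝ => Real.exp (-lam * x)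
        * (lam * (B * Real.exp (lam * ((B + 1) * L))))) (Set.Ioi 0) :=
      (integrableOn_exp_mul_Ioi (by linarith) 0).mul_const _
    refine h1.mono' hfm.aestronglyMeasurable ?_
    refine (ae_restrict_iff' measurableSet_Ioi).2 (Eventually.of_forall fun x hx => ?_)
    have hx0 : 0 ≤ t + x := add_nonneg ht (le_of_lt hx)
    have h2 := mul_le_mul (hB (t + x)) (hEb _ hx0) (norm_nonneg _) hB0
    have h3 : ‖f x‖ = lam * Real.exp (-(lam * x))
        * (‖φ (t + x)‖ * ‖Complex.exp (lam * I (t + x))‖) := by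
      rw [hf, ← norm_mul, norm_smul, Real.norm_of_nonneg (mul_nonneg hlam.le (Real.exp_pos _).le)]
    calc ‖f x‖ ≤ lam * Real.exp (-(lam * x)) * (B * Real.exp (lam * ((B + 1) * L))) :=
          h3 ▸ mul_le_mul_of_nonneg_left h2 (mul_nonneg hlam.le (Real.exp_pos _).le)
      _ = _ := by rw [neg_mul]; ring
  have hFTC : ∀ R, 0 ≤ R → ∫ x in (0 : ℝ)..R, f x = F R - F 0 := by
    intro R hR
    refine integral_eq_of_hasDerivAt_off_countable_of_le F f hR
      (s := (fun y => y - t) '' K) (hK.image _) ?_ ?_ ?_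
    · refine Continuous.continuousOn ?_
      fun_prop
    · rintro x ⟨_, hx⟩
      have hxK : t + x ∉ K := fun h => hx ⟨t + x, h, by ring⟩
      have h1 : HasDerivAt (fun x : ℝ => Real.exp (-(lam * x)))
          (Real.exp (-(lam * x)) * -(lam * 1)) x :=
        (((hasDerivAt_id x).const_mul lam).neg).exp
      have h2 : HasDerivAt (fun x : ℝ => I (t + x)) (-(φ (t + x) - 1)) x := by
        simpa using (hIderiv _ hxK).comp_const_add t x
      have h3 := (h2.const_mul (lam : ℂ)).cexp
      have h4 := (h1.smul h3).neg
      refine h4.congr_deriv ?_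
      simp only [hf, Complex.real_smul]
      push_cast
      ring
    · rw [intervalIntegrable_iff_integrableOn_Ioc_of_le hR]
      exact hfint.mono_set Set.Ioc_subset_Ioi_self
  have hlim1 : Tendsto (fun R => ∫ x in (0 : ℝ)..R, f x) atTop
      (𝓝 (∫ x in Set.Ioi 0, f x)) :=
    intervalIntegral_tendsto_integral_Ioi 0 hfint tendsto_id
  have hFlim : Tendsto F atTop (𝓝 0) := by
    refine squeeze_zero_norm' (a := fun x =>
      Real.exp (-(lam * x)) * Real.exp (lam * ((B + 1) * L))) ?_ ?_
    · filter_upwards [eventually_ge_atTop 0] with x hx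
      rw [hF, norm_neg, norm_smul, Real.norm_of_nonneg (Real.exp_pos _).le]
      exact mul_le_mul_of_nonneg_left (hEb _ (by positivity)) (Real.exp_pos _).le
    · have : Tendsto (fun x => Real.exp (-(lam * x))) atTop (𝓝 0) :=
        Real.tendsto_exp_neg_atTop_nhds_zero.comp (tendsto_id.const_mul_atTop hlam)
      simpa using this.mul_const (Real.exp (lam * ((B + 1) * L)))
  have hlim2 : Tendsto (fun R => ∫ x in (0 : ℝ)..R, f x) atTop (𝓝 (0 - F 0)) := by
    refine (hFlim.sub_const (F 0)).congr' ?_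
    filter_upwards [eventually_ge_atTop 0] with R hR using (hFTC R hR).symm
  rw [tendsto_nhds_unique hlim1 hlim2]
  simp [hF, hI]

/-! ### Product functionals of a marked Poisson process -/

/-- Law of the past of a Poisson process of rate `lam` with independent marks of law `μ`. -/
abbrev markedLaw {M : Type*} [MeasurableSpace M] (μ : Measure M) (lam : ℝ) :
    Measure (ℕ → ℝ × M) :=
  Measure.infinitePi fun _ : ℕ => (expMeasure lam).prod μ

/-- Expectation of the product of `ψ` over the points of the marked process beyond distance `t`. -/
def tailFactor {M : Type*} [MeasurableSpace M] (μ : Measure M) (lam L : ℝ) (ψ : ℝ × M → ℂ)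
    (t : ℝ) : ℂ :=
  -- Truncation at `0` keeps the factor bounded for every real `t`; gaps are nonnegative only almost
  -- surely.
  Complex.exp (lam * ∫ y in (max t 0)..L, ((∫ m, ψ (y, m) ∂μ) - 1))

section
variable {M : Type*} [MeasurableSpace M] {μ : Measure M} {lam L B : ℝ} {ψ : ℝ × M → ℂ}

lemma norm_integral_mark_le [IsProbabilityMeasure μ] (hψB : ∀ z, ‖ψ z‖ ≤ B) (y : ℝ) :
    ‖∫ m, ψ (y, m) ∂μ‖ ≤ B := by
  simpa using norm_integral_le_of_norm_le_const (μ := μ) (Eventually.of_forall fun m => hψB (y, m))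

lemma integral_mark_eq_one [IsProbabilityMeasure μ]
    (hψL : ∀ y, L ≤ y → ∀ᵐ m ∂μ, ψ (y, m) = 1) (y : ℝ) (hy : L ≤ y) :
    ∫ m, ψ (y, m) ∂μ = 1 := by
  rw [integral_congr_ae (hψL y hy)]; simp

lemma norm_tailFactor_le [IsProbabilityMeasure μ] (hlam : 0 < lam) (hL : 0 ≤ L)
    (hψB : ∀ z, ‖ψ z‖ ≤ B)
    (hψL : ∀ y, L ≤ y → ∀ᵐ m ∂μ, ψ (y, m) = 1) (t : ℝ) :
    ‖tailFactor μ lam L ψ t‖ ≤ Real.exp (lam * ((B + 1) * L)) := by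
  refine (Complex.norm_exp_le_exp_norm _).trans (Real.exp_le_exp.2 ?_)
  rw [norm_mul, Complex.norm_real, Real.norm_of_nonneg hlam.le]
  exact mul_le_mul_of_nonneg_left (norm_integral_sub_one_le hL (norm_integral_mark_le hψB)
    (integral_mark_eq_one hψL) (le_max_right _ _)) hlam.le

lemma tailFactor_eq_one [IsProbabilityMeasure μ] (hL : 0 ≤ L)
    (hψL : ∀ y, L ≤ y → ∀ᵐ m ∂μ, ψ (y, m) = 1) {t : ℝ} (ht : L ≤ t) :
    tailFactor μ lam L ψ t = 1 := by
  rw [tailFactor, intervalIntegral.integral_congr (g := fun _ => 0)]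
  · simp
  · intro y hy
    rw [max_eq_left (hL.trans ht), Set.uIcc_of_ge ht] at hy
    simp [integral_mark_eq_one hψL y hy.1]

lemma measurable_integral_mark [SFinite μ] (hψ : Measurable ψ) :
    Measurable fun y => ∫ m, ψ (y, m) ∂μ :=
  (hψ.stronglyMeasurable.integral_prod_right' (ν := μ)).measurable

lemma measurable_tailFactor [IsProbabilityMeasure μ] (hψ : Measurable ψ) (hψB : ∀ z, ‖ψ z‖ ≤ B) :
    Measurable (tailFactor μ lam L ψ) := by
  have hii : ∀ a b, IntervalIntegrable (fun y => (∫ m, ψ (y, m) ∂μ) - 1) volume a b := by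
    intro a b
    refine IntervalIntegrable.sub ?_ intervalIntegrable_const
    refine (intervalIntegrable_const (c := B)).mono_fun
      (measurable_integral_mark hψ).aestronglyMeasurable ?_
    exact Eventually.of_forall fun y => (norm_integral_mark_le hψB y).trans (le_abs_self B)
  have h : Continuous fun s => ∫ y in s..L, ((∫ m, ψ (y, m) ∂μ) - 1) := by
    have h2 : (fun s => ∫ y in s..L, ((∫ m, ψ (y, m) ∂μ) - 1))
        = fun s => -∫ y in L..s, ((∫ m, ψ (y, m) ∂μ) - 1) := by
      ext s; exact intervalIntegral.integral_symm L s
    rw [h2]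
    exact (intervalIntegral.continuous_primitive hii L).neg
  have h3 : Continuous (tailFactor μ lam L ψ) := by
    unfold tailFactor
    exact Complex.continuous_exp.comp (continuous_const.mul
      (h.comp (continuous_id.max continuous_const)))
  exact h3.measurable

/-- The multiplicative functional of a marked Poisson process. -/
theorem integral_prod_mul_tailFactor [IsProbabilityMeasure μ] (hlam : 0 < lam) (hL : 0 ≤ L)
    (hψ : Measurable ψ) (hψB : ∀ z, ‖ψ z‖ ≤ B)
    (hψL : ∀ y, L ≤ y → ∀ᵐ m ∂μ, ψ (y, m) = 1) {K : Set ℝ} (hK : K.Countable)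
    (hc : ∀ y, y ∉ K → ∀ m, ContinuousAt (fun y => ψ (y, m)) y) (n : ℕ) :
    ∫ ω, (∏ k ∈ Finset.range n, ψ (elapsed ω (k + 1), (ω k).2))
        * tailFactor μ lam L ψ (elapsed ω n) ∂(markedLaw μ lam)
      = Complex.exp (lam * ∫ y in (0 : ℝ)..L, ((∫ m, ψ (y, m) ∂μ) - 1)) := by
  have := isProbabilityMeasure_expMeasure hlam
  have hH := measurable_tailFactor (μ := μ) (lam := lam) (L := L) hψ hψB
  have hHb := norm_tailFactor_le (μ := μ) hlam hL hψB hψL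
  have hν : ∀ᵐ z ∂((expMeasure lam).prod μ), 0 ≤ z.1 :=
    Measure.quasiMeasurePreserving_fst.ae (ae_expMeasure_nonneg lam)
  have key := integral_prod_mul_of_step hν hψ hψB hH hHb (fun t ht => ?_) n 0 le_rfl
  · simpa [tailFactor] using key
  · have hmeas : Measurable fun z : ℝ × M =>
        ψ (t + z.1, z.2) * tailFactor μ lam L ψ (t + z.1) :=
      (hψ.comp ((measurable_fst.const_add t).prodMk measurable_snd)).mul
        (hH.comp (measurable_fst.const_add t))
    have hB0 : 0 ≤ B := by
      obtain ⟨m⟩ : Nonempty M := nonempty_of_isProbabilityMeasure μ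
      exact (norm_nonneg _).trans (hψB (0, m))
    have hint : Integrable (fun z : ℝ × M => ψ (t + z.1, z.2) * tailFactor μ lam L ψ (t + z.1))
        ((expMeasure lam).prod μ) :=
      Integrable.of_bound hmeas.aestronglyMeasurable (B * Real.exp (lam * ((B + 1) * L)))
        (Eventually.of_forall fun z => by
          rw [norm_mul]
          exact mul_le_mul (hψB _) (hHb _) (norm_nonneg _) hB0)
    rw [integral_prod _ hint]
    simp only [integral_mul_const]
    rw [integral_expMeasure hlam]
    have hcφ : ∀ y, y ∉ K → ContinuousAt (fun y => ∫ m, ψ (y, m) ∂μ) y := by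
      intro y hy
      refine continuousAt_of_dominated (bound := fun _ => B) ?_ ?_ (integrable_const _) ?_
      · exact Eventually.of_forall fun y =>
          (hψ.comp (measurable_const.prodMk measurable_id)).aestronglyMeasurable
      · exact Eventually.of_forall fun y => Eventually.of_forall fun m => hψB _
      · exact Eventually.of_forall fun m => hc y hy m
    have hr := renewal_identity hlam (measurable_integral_mark (μ := μ) hψ) hL
      (norm_integral_mark_le hψB) (integral_mark_eq_one hψL) hK hcφ ht
    rw [tailFactor, max_eq_left ht, ← hr]
    refine setIntegral_congr_fun measurableSet_Ioi fun x hx => ?_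
    have hx0 : 0 ≤ t + x := add_nonneg ht (le_of_lt hx)
    simp only [tailFactor, max_eq_left hx0]

/-- The Laplace transform of the `n`-th arrival distance decays geometrically, so Markov's
inequality applies. It lets `n` points stand for the whole past. -/
lemma tendsto_measureReal_elapsed_lt [IsProbabilityMeasure μ] (hlam : 0 < lam) (L : ℝ) :
    Tendsto (fun n => (markedLaw μ lam).real {ω | elapsed ω n < L}) atTop (𝓝 0) := by
  have := isProbabilityMeasure_expMeasure hlam
  have hν : ∀ᵐ z ∂((expMeasure lam).prod μ), 0 ≤ z.1 :=
    Measure.quasiMeasurePreserving_fst.ae (ae_expMeasure_nonneg lam)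
  -- The inverse of `E[exp (-gap)] = lam / (lam + 1)`, which makes `exp (-t)` invariant.
  set c : ℝ := (lam + 1) / lam with hc
  set H : ℝ → ℂ := fun t => (Real.exp (-max t 0) : ℝ) with hH
  have hstep : ∀ t, 0 ≤ t → ∫ z, (c : ℂ) * H (t + z.1) ∂((expMeasure lam).prod μ) = H t := by
    intro t ht
    have h1 := integral_prod_mul (μ := expMeasure lam) (ν := μ)
      (fun x => (c : ℂ) * H (t + x)) (fun _ => (1 : ℂ))
    simp only [mul_one, integral_const, probReal_univ, one_smul] at h1
    rw [h1, integral_expMeasure hlam]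
    have h2 : ∀ x ∈ Set.Ioi (0 : ℝ), (lam * Real.exp (-(lam * x)) : ℝ) • ((c : ℂ) * H (t + x))
        = (((lam + 1) * Real.exp (-t) * Real.exp (-(lam + 1) * x) : ℝ) : ℂ) := by
      intro x hx
      have hx0 : 0 ≤ t + x := add_nonneg ht (le_of_lt hx)
      simp only [hH, max_eq_left hx0, Complex.real_smul, ← Complex.ofReal_mul]
      congr 1
      have : Real.exp (-(lam + 1) * x) = Real.exp (-(lam * x)) * Real.exp (-x) := by
        rw [← Real.exp_add]; congr 1; ring
      rw [this, neg_add, Real.exp_add, hc]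
      field_simp
    rw [setIntegral_congr_fun measurableSet_Ioi h2, integral_complex_ofReal, integral_const_mul,
      integral_exp_mul_Ioi (by linarith)]
    simp only [hH, max_eq_left ht]
    congr 1
    have : lam + 1 ≠ 0 := by positivity
    rw [mul_zero, Real.exp_zero, neg_div_neg_eq]
    field_simp
  have hHm : Measurable H := by
    have : Continuous H := by fun_prop
    exact this.measurable
  have key := fun n => integral_prod_mul_of_step hν (ψ := fun _ => (c : ℂ)) measurable_const
    (fun _ => le_rfl) hHm (C := 1) (fun t => by
      simp only [hH, Complex.norm_real, Real.norm_of_nonneg (Real.exp_pos _).le]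
      exact Real.exp_le_one_iff.2 (by simp)) hstep n 0 le_rfl
  have hval : ∀ n, ∫ ω, Real.exp (-max (elapsed ω n) 0) ∂(markedLaw μ lam) = (c⁻¹) ^ n := by
    intro n
    have h := key n
    simp only [Finset.prod_const, Finset.card_range, zero_add] at h
    rw [integral_const_mul] at h
    simp only [hH] at h
    rw [integral_complex_ofReal] at h
    have hc0 : c ≠ 0 := by positivity
    have h' : c ^ n * ∫ ω, Real.exp (-max (elapsed ω n) 0) ∂(markedLaw μ lam) = 1 := by
      rw [max_self, neg_zero, Real.exp_zero] at h
      exact_mod_cast h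
    rw [inv_pow]
    exact eq_inv_of_mul_eq_one_right h'
  have hbound : ∀ n, (markedLaw μ lam).real {ω | elapsed ω n < L}
      ≤ Real.exp (max L 0) * (c⁻¹) ^ n := by
    intro n
    have hm : Measurable fun ω : ℕ → ℝ × M => Real.exp (-max (elapsed ω n) 0) := by
      have := measurable_elapsed (M := M) n
      fun_prop
    have h := mul_meas_ge_le_integral_of_nonneg (μ := markedLaw μ lam)
      (f := fun ω => Real.exp (-max (elapsed ω n) 0))
      (Eventually.of_forall fun ω => (Real.exp_pos _).le)
      (Integrable.of_bound hm.aestronglyMeasurable 1 (Eventually.of_forall fun ω => by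
        rw [Real.norm_of_nonneg (Real.exp_pos _).le]
        exact Real.exp_le_one_iff.2 (by simp))) (Real.exp (-max L 0))
    rw [hval] at h
    have h2 : (markedLaw μ lam).real {ω | elapsed ω n < L} ≤
        (markedLaw μ lam).real {ω | Real.exp (-max L 0) ≤ Real.exp (-max (elapsed ω n) 0)} :=
      measureReal_mono fun ω (hω : elapsed ω n < L) => by
        simp only [Set.mem_ofPred_eq, Real.exp_le_exp, neg_le_neg_iff]
        exact max_le_max hω.le le_rfl
    calc _ ≤ _ := h2
      _ = Real.exp (max L 0) * (Real.exp (-max L 0) *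
          (markedLaw μ lam).real {ω | Real.exp (-max L 0) ≤ Real.exp (-max (elapsed ω n) 0)}) := by
        rw [← mul_assoc, ← Real.exp_add]; simp
      _ ≤ _ := mul_le_mul_of_nonneg_left h (Real.exp_pos _).le
  have hc1 : c⁻¹ < 1 := by
    rw [hc, inv_div, div_lt_one (by positivity)]; linarith
  have hlim : Tendsto (fun n : ℕ => Real.exp (max L 0) * (c⁻¹) ^ n) atTop (𝓝 0) := by
    simpa using (tendsto_pow_atTop_nhds_zero_of_lt_one (by positivity) hc1).const_mul
      (Real.exp (max L 0))
  exact squeeze_zero (fun n => measureReal_nonneg) hbound hlim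

end

/-! ### Chernoff bounds and characteristic functions of Poisson sums -/

section
variable {M : Type*} [MeasurableSpace M] {μ : Measure M} [IsProbabilityMeasure μ]
  {lam L b : ℝ} {f : ℝ × M → ℝ}

/-- The sum of `f` over the `n` most recent points of a marked process. -/
def pointSum {M : Type*} (f : ℝ × M → ℝ) (n : ℕ) (ω : ℕ → ℝ × M) : ℝ :=
  ∑ k ∈ Finset.range n, f (elapsed ω (k + 1), (ω k).2)

omit [IsProbabilityMeasure μ] in
lemma measurable_pointSum (hf : Measurable f) (n : ℕ) : Measurable (pointSum f n) :=
  Finset.measurable_sum _ fun k _ => hf.comp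
    ((measurable_elapsed _).prodMk (measurable_snd.comp (measurable_pi_apply k)))

lemma integrable_exp_mark (hf : Measurable f) (hb : ∀ z, |f z| ≤ b) (y : ℝ) :
    Integrable (fun m => Real.exp (f (y, m))) μ := by
  refine Integrable.of_bound (C := Real.exp b) ?_ ?_
  · exact (hf.comp (measurable_const.prodMk measurable_id)).exp.aestronglyMeasurable
  · refine Eventually.of_forall fun m => ?_
    rw [Real.norm_of_nonneg (Real.exp_pos _).le]
    exact Real.exp_le_exp.2 ((le_abs_self _).trans (hb _))

/-- Chernoff bound for a marked Poisson process. -/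
theorem measureReal_le_pointSum_le (hlam : 0 < lam) (hL : 0 ≤ L)
    (hf : Measurable f) (hb : ∀ z, |f z| ≤ b) (hfL : ∀ y, L ≤ y → ∀ᵐ m ∂μ, f (y, m) = 0)
    {K : Set ℝ} (hK : K.Countable)
    (hc : ∀ y, y ∉ K → ∀ m, ContinuousAt (fun y => f (y, m)) y) (n : ℕ) (x : ℝ) :
    (markedLaw μ lam).real {ω | x ≤ pointSum f n ω ∧ L ≤ elapsed ω n}
      ≤ Real.exp (-x + lam * ∫ y in (0 : ℝ)..L, ((∫ m, Real.exp (f (y, m)) ∂μ) - 1)) := by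
  have := isProbabilityMeasure_expMeasure hlam
  set ψ : ℝ × M → ℂ := fun z => (Real.exp (f z) : ℝ) with hψ
  have hψm : Measurable ψ := Complex.measurable_ofReal.comp hf.exp
  have hψB : ∀ z, ‖ψ z‖ ≤ Real.exp b := by
    intro z
    rw [hψ, Complex.norm_real, Real.norm_of_nonneg (Real.exp_pos _).le]
    exact Real.exp_le_exp.2 ((le_abs_self _).trans (hb z))
  have hψL : ∀ y, L ≤ y → ∀ᵐ m ∂μ, ψ (y, m) = 1 := by
    intro y hy
    filter_upwards [hfL y hy] with m hm
    simp [hψ, hm]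
  have hψc : ∀ y, y ∉ K → ∀ m, ContinuousAt (fun y => ψ (y, m)) y := by
    intro y hy m
    exact Complex.continuous_ofReal.continuousAt.comp (hc y hy m).rexp
  have key := integral_prod_mul_tailFactor hlam hL hψm hψB hψL hK hψc n
  have hreal : ∀ t, ∫ y in t..L, ((∫ m, ψ (y, m) ∂μ) - 1)
      = ((∫ y in t..L, ((∫ m, Real.exp (f (y, m)) ∂μ) - 1) : ℝ) : ℂ) := by
    intro t
    rw [← intervalIntegral.integral_ofReal]
    congr 1
    ext y
    rw [hψ, integral_complex_ofReal]
    push_cast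
    rfl
  set h : ℝ → ℝ := fun t =>
    Real.exp (lam * ∫ y in (max t 0)..L, ((∫ m, Real.exp (f (y, m)) ∂μ) - 1)) with hh
  have htail : ∀ t, tailFactor μ lam L ψ t = (h t : ℂ) := by
    intro t
    rw [tailFactor, hreal, hh]
    push_cast
    rfl
  have hZ : ∀ ω, (∏ k ∈ Finset.range n, ψ (elapsed ω (k + 1), (ω k).2))
      * tailFactor μ lam L ψ (elapsed ω n)
      = ((Real.exp (pointSum f n ω) * h (elapsed ω n) : ℝ) : ℂ) := by
    intro ω
    rw [htail, pointSum, Real.exp_sum]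
    push_cast
    simp [hψ]
  simp only [hZ] at key
  rw [integral_complex_ofReal, hreal] at key
  have hval : ∫ ω, Real.exp (pointSum f n ω) * h (elapsed ω n) ∂(markedLaw μ lam)
      = Real.exp (lam * ∫ y in (0 : ℝ)..L, ((∫ m, Real.exp (f (y, m)) ∂μ) - 1)) := by
    exact_mod_cast key
  have hhm : Measurable h := by
    have h1 := measurable_tailFactor (μ := μ) (lam := lam) (L := L) hψm hψB
    have h2 : h = fun t => (tailFactor μ lam L ψ t).re := by
      ext t; rw [htail, Complex.ofReal_re]
    rw [h2]
    exact Complex.measurable_re.comp h1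
  have hint : Integrable (fun ω => Real.exp (pointSum f n ω) * h (elapsed ω n))
      (markedLaw μ lam) := by
    refine Integrable.of_bound (C := Real.exp (n * b) * Real.exp (lam * ((Real.exp b + 1) * L)))
      ((measurable_pointSum hf n).exp.mul
        (hhm.comp (measurable_elapsed n))).aestronglyMeasurable (Eventually.of_forall fun ω => ?_)
    rw [norm_mul, Real.norm_of_nonneg (Real.exp_pos _).le]
    refine mul_le_mul (Real.exp_le_exp.2 ?_) ?_ (norm_nonneg _) (Real.exp_pos _).le
    · calc pointSum f n ω ≤ ∑ k ∈ Finset.range n, b :=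
            Finset.sum_le_sum fun k _ => (le_abs_self _).trans (hb _)
        _ = n * b := by simp
    · have := norm_tailFactor_le (μ := μ) hlam hL hψB hψL (elapsed ω n)
      rwa [htail, Complex.norm_real] at this
  have hmk := mul_meas_ge_le_integral_of_nonneg (Eventually.of_forall fun ω =>
    mul_nonneg (Real.exp_pos _).le (Real.exp_pos _).le) hint (Real.exp x)
  rw [hval] at hmk
  have hsub : (markedLaw μ lam).real {ω | x ≤ pointSum f n ω ∧ L ≤ elapsed ω n}
      ≤ (markedLaw μ lam).real
        {ω | Real.exp x ≤ Real.exp (pointSum f n ω) * h (elapsed ω n)} := by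
    refine measureReal_mono ?_
    rintro ω ⟨h1, h2⟩
    -- Once the first `n` points reach beyond `L`, the remaining ones contribute nothing, so the
    -- tail factor can be dropped before Markov's inequality.
    have h3 : h (elapsed ω n) = 1 := by
      have := tailFactor_eq_one (lam := lam) hL hψL h2
      rw [htail] at this
      exact_mod_cast this
    simpa [h3] using h1
  calc _ ≤ _ := hsub
    _ = Real.exp (-x) * (Real.exp x * (markedLaw μ lam).real
        {ω | Real.exp x ≤ Real.exp (pointSum f n ω) * h (elapsed ω n)}) := by
      rw [← mul_assoc, ← Real.exp_add]; simp
    _ ≤ _ := by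
      rw [Real.exp_add]
      exact mul_le_mul_of_nonneg_left hmk (Real.exp_pos _).le

/-- Chernoff bound in terms of the first two moments of the intensity. -/
theorem measureReal_le_pointSum_le_of_integral_le (hlam : 0 < lam) (hL : 0 ≤ L)
    (hf : Measurable f) (hb : ∀ z, |f z| ≤ 1) (hfL : ∀ y, L ≤ y → ∀ᵐ m ∂μ, f (y, m) = 0)
    {K : Set ℝ} (hK : K.Countable)
    (hc : ∀ y, y ∉ K → ∀ m, ContinuousAt (fun y => f (y, m)) y) (n : ℕ) (x : ℝ)
    {G : M → ℝ} (hG : Integrable G μ)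
    (hfG : ∀ᵐ m ∂μ, ∫ y in (0 : ℝ)..L, (f (y, m) + f (y, m) ^ 2) ≤ G m) :
    (markedLaw μ lam).real {ω | x ≤ pointSum f n ω ∧ L ≤ elapsed ω n}
      ≤ Real.exp (-x + lam * ∫ m, G m ∂μ) := by
  refine (measureReal_le_pointSum_le hlam hL hf hb hfL hK hc n x).trans ?_
  refine Real.exp_le_exp.2 (add_le_add_right (mul_le_mul_of_nonneg_left ?_ hlam.le) _)
  have hgm : Measurable fun z : ℝ × M => f z + f z ^ 2 := hf.add (hf.pow_const 2)
  have hgb : ∀ z : ℝ × M, ‖f z + f z ^ 2‖ ≤ 2 := by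
    intro z
    have h1 := hb z
    have h2 : |f z ^ 2| ≤ 1 := by
      rw [abs_pow]; exact pow_le_one₀ (abs_nonneg _) h1
    rw [Real.norm_eq_abs]
    exact (abs_add_le _ _).trans (by linarith)
  have hgi : ∀ y, Integrable (fun m => f (y, m) + f (y, m) ^ 2) μ := fun y =>
    Integrable.of_bound (hgm.comp (measurable_const.prodMk measurable_id)).aestronglyMeasurable 2
      (Eventually.of_forall fun m => hgb _)
  -- From `exp x ≤ 1 + x + x ^ 2` for `|x| ≤ 1`.
  have hexp : ∀ y, (∫ m, Real.exp (f (y, m)) ∂μ) - 1 ≤ ∫ m, (f (y, m) + f (y, m) ^ 2) ∂μ := by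
    intro y
    have h1 : (∫ m, Real.exp (f (y, m)) ∂μ) - 1 = ∫ m, (Real.exp (f (y, m)) - 1) ∂μ := by
      rw [integral_sub (integrable_exp_mark hf hb y) (integrable_const _)]; simp
    rw [h1]
    refine integral_mono ((integrable_exp_mark hf hb y).sub (integrable_const _)) (hgi y)
      fun m => ?_
    have := Real.abs_exp_sub_one_sub_id_le (hb (y, m))
    have := (abs_le.1 this).2
    simp only
    linarith
  have hm1 : Measurable fun y => ∫ m, Real.exp (f (y, m)) ∂μ :=
    (hf.exp.stronglyMeasurable.integral_prod_right' (ν := μ)).measurable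
  have hm2 : Measurable fun y => ∫ m, (f (y, m) + f (y, m) ^ 2) ∂μ :=
    (hgm.stronglyMeasurable.integral_prod_right' (ν := μ)).measurable
  have hb1 : ∀ y, ‖(∫ m, Real.exp (f (y, m)) ∂μ) - 1‖ ≤ Real.exp 1 + 1 := by
    intro y
    refine (norm_sub_le _ _).trans (add_le_add ?_ (by simp))
    simpa using norm_integral_le_of_norm_le_const (μ := μ) (C := Real.exp 1)
      (f := fun m => Real.exp (f (y, m))) (Eventually.of_forall fun m => by
        rw [Real.norm_of_nonneg (Real.exp_pos _).le]
        exact Real.exp_le_exp.2 ((le_abs_self _).trans (hb _)))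
  have hb2 : ∀ y, ‖∫ m, (f (y, m) + f (y, m) ^ 2) ∂μ‖ ≤ 2 := by
    intro y
    simpa using norm_integral_le_of_norm_le_const (μ := μ)
      (f := fun m => f (y, m) + f (y, m) ^ 2) (Eventually.of_forall fun m => hgb (y, m))
  have hswap : ∫ y in (0 : ℝ)..L, ∫ m, (f (y, m) + f (y, m) ^ 2) ∂μ
      = ∫ m, (∫ y in (0 : ℝ)..L, (f (y, m) + f (y, m) ^ 2)) ∂μ := by
    simp only [intervalIntegral.integral_of_le hL]
    refine integral_integral_swap (f := fun y m => f (y, m) + f (y, m) ^ 2) ?_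
    exact Integrable.of_bound hgm.aestronglyMeasurable 2 (Eventually.of_forall fun z => hgb z)
  have hmono : ∫ y in (0 : ℝ)..L, ((∫ m, Real.exp (f (y, m)) ∂μ) - 1)
      ≤ ∫ y in (0 : ℝ)..L, ∫ m, (f (y, m) + f (y, m) ^ 2) ∂μ := by
    refine intervalIntegral.integral_mono_on hL ?_ ?_ fun y _ => hexp y
    · exact (intervalIntegrable_const (c := Real.exp 1 + 1)).mono_fun
        (hm1.sub_const 1).aestronglyMeasurable
        (Eventually.of_forall fun y => (hb1 y).trans (le_abs_self _))
    · exact (intervalIntegrable_const (c := (2 : ℝ))).mono_fun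
        hm2.aestronglyMeasurable (Eventually.of_forall fun y => (hb2 y).trans (le_abs_self _))
  refine hmono.trans (hswap ▸ integral_mono_ae ?_ hG hfG)
  simp only [intervalIntegral.integral_of_le hL]
  have hprod : Integrable (fun z : ℝ × M => f z + f z ^ 2)
      ((volume.restrict (Set.Ioc 0 L)).prod μ) :=
    Integrable.of_bound hgm.aestronglyMeasurable 2 (Eventually.of_forall fun z => hgb z)
  exact hprod.integral_prod_right

/-- The characteristic function of a sum over a marked Poisson process. -/
theorem norm_integral_cexp_pointSum_sub_le (hlam : 0 < lam) (hL : 0 ≤ L)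
    (hf : Measurable f) (hfL : ∀ y, L ≤ y → ∀ᵐ m ∂μ, f (y, m) = 0)
    {K : Set ℝ} (hK : K.Countable)
    (hc : ∀ y, y ∉ K → ∀ m, ContinuousAt (fun y => f (y, m)) y) (n : ℕ) (s : ℝ) :
    ‖∫ ω, Complex.exp ((s * pointSum f n ω : ℝ) * Complex.I) ∂(markedLaw μ lam)
      - Complex.exp (lam * ∫ y in (0 : ℝ)..L,
          ((∫ m, Complex.exp ((s * f (y, m) : ℝ) * Complex.I) ∂μ) - 1))‖
      ≤ (1 + Real.exp (lam * (2 * L))) * (markedLaw μ lam).real {ω | elapsed ω n < L} := by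
  have := isProbabilityMeasure_expMeasure hlam
  set ψ : ℝ × M → ℂ := fun z => Complex.exp ((s * f z : ℝ) * Complex.I) with hψ
  have hψm : Measurable ψ :=
    ((Complex.measurable_ofReal.comp (hf.const_mul s)).mul_const _).cexp
  have hψB : ∀ z, ‖ψ z‖ ≤ 1 := fun z => (Complex.norm_exp_ofReal_mul_I _).le
  have hψL : ∀ y, L ≤ y → ∀ᵐ m ∂μ, ψ (y, m) = 1 := by
    intro y hy
    filter_upwards [hfL y hy] with m hm
    simp [hψ, hm]
  have hψc : ∀ y, y ∉ K → ∀ m, ContinuousAt (fun y => ψ (y, m)) y := by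
    intro y hy m
    have h1 : ContinuousAt (fun y => ((s * f (y, m) : ℝ) : ℂ)) y :=
      Complex.continuous_ofReal.continuousAt.comp (continuousAt_const.mul (hc y hy m))
    exact (h1.mul continuousAt_const).cexp
  have key := integral_prod_mul_tailFactor hlam hL hψm hψB hψL hK hψc n
  have hprod : ∀ ω, (∏ k ∈ Finset.range n, ψ (elapsed ω (k + 1), (ω k).2))
      = Complex.exp ((s * pointSum f n ω : ℝ) * Complex.I) := by
    intro ω
    rw [hψ, ← Complex.exp_sum, pointSum, Finset.mul_sum]
    push_cast
    rw [Finset.sum_mul]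
  simp only [hprod] at key
  have hem : Measurable fun ω => Complex.exp ((s * pointSum f n ω : ℝ) * Complex.I) :=
    ((Complex.measurable_ofReal.comp ((measurable_pointSum hf n).const_mul s)).mul_const _).cexp
  have hHm := (measurable_tailFactor (μ := μ) (lam := lam) (L := L) hψm hψB).comp
    (measurable_elapsed (M := M) n)
  have hHb := norm_tailFactor_le (μ := μ) hlam hL hψB hψL
  have hi1 : Integrable (fun ω => Complex.exp ((s * pointSum f n ω : ℝ) * Complex.I))
      (markedLaw μ lam) :=
    Integrable.of_bound hem.aestronglyMeasurable 1
      (Eventually.of_forall fun ω => (Complex.norm_exp_ofReal_mul_I _).le)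
  have hi2 : Integrable (fun ω => Complex.exp ((s * pointSum f n ω : ℝ) * Complex.I)
      * tailFactor μ lam L ψ (elapsed ω n)) (markedLaw μ lam) :=
    Integrable.of_bound (hem.mul hHm).aestronglyMeasurable
      (Real.exp (lam * ((1 + 1) * L))) (Eventually.of_forall fun ω => by
        rw [norm_mul, Complex.norm_exp_ofReal_mul_I, one_mul]; exact hHb _)
  rw [← key, ← integral_sub hi1 hi2]
  have hS : MeasurableSet {ω : ℕ → ℝ × M | elapsed ω n < L} :=
    measurableSet_lt (measurable_elapsed n) measurable_const
  calc _ ≤ ∫ ω, {ω : ℕ → ℝ × M | elapsed ω n < L}.indicator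
        (fun _ => 1 + Real.exp (lam * (2 * L))) ω ∂(markedLaw μ lam) := by
        refine norm_integral_le_of_norm_le ((integrable_const _).indicator hS)
          (Eventually.of_forall fun ω => ?_)
        have h0 : Complex.exp ((s * pointSum f n ω : ℝ) * Complex.I)
            - Complex.exp ((s * pointSum f n ω : ℝ) * Complex.I)
              * tailFactor μ lam L ψ (elapsed ω n)
            = Complex.exp ((s * pointSum f n ω : ℝ) * Complex.I)
              * (1 - tailFactor μ lam L ψ (elapsed ω n)) := by ring
        rw [h0, norm_mul, Complex.norm_exp_ofReal_mul_I, one_mul]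
        -- The tail factor differs from `1` only if the `n` points fail to cover `[0, L]`; there the
        -- crude bound is used.
        by_cases hω : elapsed ω n < L
        · rw [Set.indicator_of_mem (by exact hω)]
          refine (norm_sub_le _ _).trans (add_le_add (by simp) ?_)
          have h1 := hHb (elapsed ω n)
          rwa [one_add_one_eq_two] at h1
        · rw [Set.indicator_of_notMem (by exact hω),
            tailFactor_eq_one hL hψL (not_lt.1 hω)]
          simp
    _ = _ := by
        rw [integral_indicator_const _ hS, smul_eq_mul, mul_comm]

end

/-! ### Normal approximation -/

lemma gaussianReal_Ici_zero : (gaussianReal 0 1).real (Set.Ici 0) = 1 / 2 := by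
  have hna : NullSingletonClass (gaussianReal 0 1) := nullSingletonClass_gaussianReal one_ne_zero
  have h1 : (gaussianReal 0 1).real (Set.Ici 0) = (gaussianReal 0 1).real (Set.Iic 0) := by
    have h := gaussianReal_map_neg (μ := 0) (v := 1)
    rw [neg_zero] at h
    conv_lhs => rw [← h]
    rw [map_measureReal_apply measurable_neg measurableSet_Ici]
    congr 1
    ext x
    simp
  have h2 : (gaussianReal 0 1).real (Set.Iic 0) = (gaussianReal 0 1).real (Set.Iio 0) :=
    measureReal_congr Iio_ae_eq_Iic.symm
  have h3 := measureReal_add_measureReal_compl (μ := gaussianReal 0 1)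
    (measurableSet_Ici (a := (0 : ℝ)))
  rw [Set.compl_Ici, probReal_univ] at h3
  linarith

/-- Log-characteristic function of a centred and scaled Poisson variable: the quadratic Taylor term
survives, and the cubic remainder is `O(ρ · ρ^{-3/2})`. -/
lemma tendsto_mul_cexp_sub (t : ℝ) {ρ : ℕ → ℝ} (hρ : Tendsto ρ atTop atTop) :
    Tendsto (fun k => (ρ k : ℂ) * (Complex.exp ((t / √(ρ k) : ℝ) * Complex.I) - 1
      - (t / √(ρ k) : ℝ) * Complex.I)) atTop (𝓝 (-(t ^ 2) / 2)) := by
  have hsq : Tendsto (fun k => √(ρ k)) atTop atTop := Real.tendsto_sqrt_atTop.comp hρ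
  have hz : Tendsto (fun k => |t| / √(ρ k)) atTop (𝓝 0) := hsq.const_div_atTop _
  have hbd : Tendsto (fun k => |t| ^ 2 * (|t| / √(ρ k)) * Real.exp (|t| / √(ρ k))) atTop
      (𝓝 0) := by
    simpa only [mul_zero, zero_mul, Function.comp_def] using
      (hz.const_mul (|t| ^ 2)).mul (Real.continuous_exp.continuousAt.tendsto.comp hz)
  rw [tendsto_iff_norm_sub_tendsto_zero]
  refine squeeze_zero' (Eventually.of_forall fun k => norm_nonneg _) ?_ hbd
  filter_upwards [hρ.eventually_gt_atTop 0] with k hk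
  set w := √(ρ k) with hw
  have hw0 : 0 < w := Real.sqrt_pos.2 hk
  have hρw : ρ k = w ^ 2 := (Real.sq_sqrt hk.le).symm
  have h := Complex.norm_exp_sub_sum_le_norm_mul_exp ((t / w : ℝ) * Complex.I) 3
  have hn : ‖((t / w : ℝ) : ℂ) * Complex.I‖ = |t| / w := by
    rw [norm_mul, Complex.norm_I, mul_one, Complex.norm_real, Real.norm_eq_abs, abs_div,
      abs_of_pos hw0]
  rw [hn] at h
  have hwC : (w : ℂ) ≠ 0 := by exact_mod_cast hw0.ne'
  have heq : (ρ k : ℂ) * (Complex.exp ((t / w : ℝ) * Complex.I) - 1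
      - (t / w : ℝ) * Complex.I) - (-(t ^ 2) / 2)
      = (w : ℂ) ^ 2 * (Complex.exp ((t / w : ℝ) * Complex.I)
        - ∑ m ∈ Finset.range 3, ((t / w : ℝ) * Complex.I) ^ m / (m.factorial : ℂ)) := by
    rw [hρw]
    simp only [Finset.sum_range_succ, Finset.sum_range_zero, Nat.factorial]
    push_cast
    rw [mul_pow _ Complex.I 2, Complex.I_sq]
    field_simp
    ring
  rw [heq, norm_mul, norm_pow, Complex.norm_real, Real.norm_of_nonneg hw0.le]
  calc _ ≤ w ^ 2 * ((|t| / w) ^ 3 * Real.exp (|t| / w)) :=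
        mul_le_mul_of_nonneg_left h (by positivity)
    _ = _ := by field_simp

/-- Normal approximation: variables with asymptotically Poisson characteristic functions of large
mean `ρ` are at least `ρ - ε` with probability close to one half when `ε` is small relative
to the standard deviation. -/
theorem tendsto_measureReal_sub_le {Ω : Type*} [MeasurableSpace Ω] {P : ℕ → Measure Ω}
    [∀ k, IsProbabilityMeasure (P k)] {X : ℕ → Ω → ℝ} (hX : ∀ k, Measurable (X k))
    {ρ ε δ : ℕ → ℝ} (hρ : Tendsto ρ atTop atTop)
    (hε : Tendsto (fun k => ε k / √(ρ k)) atTop (𝓝 0)) (hδ : Tendsto δ atTop (𝓝 0))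
    (hchar : ∀ k s, ‖∫ ω, Complex.exp ((s * X k ω : ℝ) * Complex.I) ∂(P k)
      - Complex.exp (ρ k * (Complex.exp (s * Complex.I) - 1))‖ ≤ δ k) :
    Tendsto (fun k => (P k).real {ω | ρ k - ε k ≤ X k ω}) atTop (𝓝 (1 / 2)) := by
  set Y : ℕ → Ω → ℝ := fun k ω => (X k ω - ρ k + ε k) / √(ρ k) with hY
  have hYm : ∀ k, Measurable (Y k) := fun k =>
    (((hX k).sub_const _).add_const _).div_const _
  let Q : ℕ → ProbabilityMeasure ℝ := fun k =>
    ⟨(P k).map (Y k), Measure.isProbabilityMeasure_map (hYm k).aemeasurable⟩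
  let G : ProbabilityMeasure ℝ := ⟨gaussianReal 0 1, inferInstance⟩
  have hQ : Tendsto Q atTop (𝓝 G) := by
    refine ProbabilityMeasure.tendsto_of_tendsto_charFun fun t => ?_
    change Tendsto (fun k => charFun ((P k).map (Y k)) t) atTop (𝓝 (charFun (gaussianReal 0 1) t))
    rw [charFun_gaussianReal]
    -- Characteristic function at `t` of the shifted and scaled Poisson variable: the first summand
    -- is the shift by `ε`, the second the centred Poisson exponent.
    set A : ℕ → ℂ := fun k => Complex.exp ((t * (ε k / √(ρ k)) : ℝ) * Complex.I
      + (ρ k : ℂ) * (Complex.exp ((t / √(ρ k) : ℝ) * Complex.I) - 1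
      - (t / √(ρ k) : ℝ) * Complex.I)) with hA
    have hAlim : Tendsto A atTop (𝓝 (Complex.exp (t * ((0 : ℝ) : ℂ) * Complex.I
        - ((1 : NNReal) : ℝ) * t ^ 2 / 2))) := by
      refine (Complex.continuous_exp.tendsto _).comp ?_
      have h1 : Tendsto (fun k => ((t * (ε k / √(ρ k)) : ℝ) : ℂ) * Complex.I) atTop
          (𝓝 (((t * 0 : ℝ) : ℂ) * Complex.I)) :=
        ((Complex.continuous_ofReal.tendsto _).comp (hε.const_mul t)).mul_const _
      convert h1.add (tendsto_mul_cexp_sub t hρ) using 2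
      simp
      ring
    have hdiff : ∀ᶠ k in atTop, ‖charFun ((P k).map (Y k)) t - A k‖ ≤ δ k := by
      filter_upwards [hρ.eventually_gt_atTop 0] with k hk
      set w := √(ρ k) with hw
      have hw0 : 0 < w := Real.sqrt_pos.2 hk
      have hρw : ρ k = w ^ 2 := (Real.sq_sqrt hk.le).symm
      have hwC : (w : ℂ) ≠ 0 := by exact_mod_cast hw0.ne'
      set c : ℝ := t * ((ε k - ρ k) / w) with hc
      have h1 : charFun ((P k).map (Y k)) t = Complex.exp (c * Complex.I)
          * ∫ ω, Complex.exp ((t / w * X k ω : ℝ) * Complex.I) ∂(P k) := by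
        rw [charFun_apply_real, integral_map (hYm k).aemeasurable
          (by fun_prop : Measurable fun x : ℝ =>
            Complex.exp (t * x * Complex.I)).aestronglyMeasurable, ← integral_const_mul]
        congr 1
        ext ω
        rw [← Complex.exp_add]
        congr 1
        simp only [hY, hc, ← hw]
        push_cast
        field_simp
        ring
      have h2 : A k = Complex.exp (c * Complex.I)
          * Complex.exp (ρ k * (Complex.exp ((t / w : ℝ) * Complex.I) - 1)) := by
        rw [hA, ← Complex.exp_add]
        simp only [← hw, hc]
        congr 1
        rw [hρw]
        push_cast
        field_simp
        ring
      rw [h1, h2, ← mul_sub, norm_mul, Complex.norm_exp_ofReal_mul_I, one_mul]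
      exact hchar k (t / w)
    have h0 : Tendsto (fun k => charFun ((P k).map (Y k)) t - A k) atTop (𝓝 0) :=
      squeeze_zero_norm' hdiff hδ
    simpa using h0.add hAlim
  -- Portmanteau theorem: the boundary point `0` carries no Gaussian mass.
  have hport := ProbabilityMeasure.tendsto_measure_of_null_frontier_of_tendsto' hQ
    (E := Set.Ici 0) (by
      have hna : NullSingletonClass (gaussianReal 0 1) := nullSingletonClass_gaussianReal one_ne_zero
      rw [frontier_Ici]
      exact measure_singleton (μ := gaussianReal 0 1) 0)
  have hreal := (ENNReal.tendsto_toReal (measure_ne_top _ _)).comp hport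
  have hG : ((G : Measure ℝ) (Set.Ici 0)).toReal = 1 / 2 := gaussianReal_Ici_zero
  rw [hG] at hreal
  refine hreal.congr' ?_
  filter_upwards [hρ.eventually_gt_atTop 0] with k hk
  have hw0 : 0 < √(ρ k) := Real.sqrt_pos.2 hk
  change ((P k).map (Y k) (Set.Ici 0)).toReal = _
  rw [Measure.map_apply (hYm k) measurableSet_Ici, measureReal_def]
  congr 2
  ext ω
  simp only [hY, Set.mem_preimage, Set.mem_Ici, Set.mem_ofPred_eq, le_div_iff₀ hw0, zero_mul]
  constructor <;> intro h <;> linarith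

/-! ### Requests that meet a time window -/

lemma integral_indicator_Icc {L : ℝ} (hL : 0 ≤ L) (a b : ℝ) :
    ∫ y in (0 : ℝ)..L, (Set.Icc a b).indicator (1 : ℝ → ℝ) y = max (min b L - max a 0) 0 := by
  rw [intervalIntegral.integral_of_le hL, ← integral_Icc_eq_integral_Ioc,
    integral_indicator_one measurableSet_Icc, measureReal_restrict_apply measurableSet_Icc,
    Set.Icc_inter_Icc, Real.volume_real_Icc]

lemma intervalIntegrable_indicator_Icc (a b c d : ℝ) :
    IntervalIntegrable ((Set.Icc a b).indicator (1 : ℝ → ℝ)) volume c d := by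
  refine (intervalIntegrable_const (c := (1 : ℝ))).mono_fun
    ((measurable_one.indicator measurableSet_Icc).aestronglyMeasurable) ?_
  exact Eventually.of_forall fun y => norm_indicator_le_norm_self _ _

lemma continuousAt_indicator_Icc {a b y : ℝ} (ha : y ≠ a) (hb : y ≠ b) :
    ContinuousAt ((Set.Icc a b).indicator (1 : ℝ → ℝ)) y := by
  refine continuousOn_const.continuousAt_indicator fun h => ?_
  rcases lt_or_ge b a with hab | hab
  · rw [Set.Icc_eq_empty (not_le.2 hab)] at h
    simp at h
  · rw [frontier_Icc hab] at h
    simp [ha, hb] at h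

/-- Indicator of the requests, made `z.1` time units before `0` with reservation and service times
`z.2`, whose reserved interval meets `[a, b]`. -/
def meets (a b : ℝ) (z : ℝ × (ℕ × ℕ)) : ℝ :=
  (Set.Icc ((z.2.1 : ℝ) - b) (z.2.1 + z.2.2 - a)).indicator 1 z.1

lemma measurable_meets (a b : ℝ) : Measurable (meets a b) := by
  have h : meets a b = {z : ℝ × (ℕ × ℕ) | (z.2.1 : ℝ) - b ≤ z.1 ∧ z.1 ≤ z.2.1 + z.2.2 - a}.indicator
      1 := rfl
  have h1 : Measurable fun m : ℕ × ℕ => (m.1 : ℝ) - b := .of_discrete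
  have h2 : Measurable fun m : ℕ × ℕ => (m.1 : ℝ) + m.2 - a := .of_discrete
  rw [h]
  refine measurable_one.indicator (MeasurableSet.inter ?_ ?_)
  · exact measurableSet_le (h1.comp measurable_snd) measurable_fst
  · exact measurableSet_le measurable_fst (h2.comp measurable_snd)

lemma meets_nonneg (a b : ℝ) (z : ℝ × (ℕ × ℕ)) : 0 ≤ meets a b z :=
  Set.indicator_nonneg (fun _ _ => zero_le_one) _

lemma meets_le_one (a b : ℝ) (z : ℝ × (ℕ × ℕ)) : meets a b z ≤ 1 :=
  Set.indicator_le_self' (fun _ _ => zero_le_one) _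

/-- Used to dominate the count at every single time `r` of a window by one count for the window,
which makes the supremum over `r` a finite union. -/
lemma meets_mono {a a' b b' : ℝ} (ha : a' ≤ a) (hb : b ≤ b') (z : ℝ × (ℕ × ℕ)) :
    meets a b z ≤ meets a' b' z :=
  Set.indicator_le_indicator_of_subset (Set.Icc_subset_Icc (by linarith) (by linarith))
    (fun _ => zero_le_one) _

/-- Distances at which some request starts or stops to meet `[a, b]`. -/
def meetsJumps (a b : ℝ) : Set ℝ :=
  Set.range (fun m : ℕ × ℕ => (m.1 : ℝ) - b) ∪ Set.range fun m : ℕ × ℕ => (m.1 : ℝ) + m.2 - a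

lemma countable_meetsJumps (a b : ℝ) : (meetsJumps a b).Countable :=
  (Set.countable_range _).union (Set.countable_range _)

lemma continuousAt_meets {a b y : ℝ} (hy : y ∉ meetsJumps a b) (m : ℕ × ℕ) :
    ContinuousAt (fun y => meets a b (y, m)) y :=
  continuousAt_indicator_Icc (fun h => hy (Or.inl ⟨m, h.symm⟩)) fun h => hy (Or.inr ⟨m, h.symm⟩)

lemma meets_eq_zero {a b y : ℝ} {u v : ℕ} (ha : 0 ≤ a) (hy : (u : ℝ) + v + 1 ≤ y) {m : ℕ × ℕ}
    (hu : m.1 ≤ u) (hv : m.2 ≤ v) : meets a b (y, m) = 0 := by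
  refine Set.indicator_of_notMem (fun h => ?_) _
  have h1 := h.2
  have h2 : (m.1 : ℝ) ≤ u := by exact_mod_cast hu
  have h3 : (m.2 : ℝ) ≤ v := by exact_mod_cast hv
  simp only at h1
  linarith

lemma sq_meets (a b : ℝ) (z : ℝ × (ℕ × ℕ)) : meets a b z ^ 2 = meets a b z := by
  by_cases h : z.1 ∈ Set.Icc ((z.2.1 : ℝ) - b) (z.2.1 + z.2.2 - a) <;> simp [meets, h]

/-- The square is the indicator of a symmetric difference. Passing from `[i, i]` to `[a, b]` moves
the left and right endpoints down by `b - i` and `a - i`, and the two strips swept out cover it. -/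
lemma sq_meets_sub_meets_le {i a b : ℝ} (hia : i ≤ a) (hib : i ≤ b) (y : ℝ) (m : ℕ × ℕ) :
    (meets a b (y, m) - meets i i (y, m)) ^ 2
      ≤ (Set.Icc ((m.1 : ℝ) - b) (m.1 - i)).indicator (1 : ℝ → ℝ) y
        + (Set.Icc ((m.1 : ℝ) + m.2 - a) (m.1 + m.2 - i)).indicator (1 : ℝ → ℝ) y := by
  simp only [meets, Set.indicator_apply, Set.mem_Icc, Pi.one_apply]
  split_ifs <;> norm_num
  all_goals grind

lemma integral_meets {L : ℝ} (hL : 0 ≤ L) (a b : ℝ) (m : ℕ × ℕ) :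
    ∫ y in (0 : ℝ)..L, meets a b (y, m)
      = max (min ((m.1 : ℝ) + m.2 - a) L - max ((m.1 : ℝ) - b) 0) 0 :=
  integral_indicator_Icc hL ((m.1 : ℝ) - b) (m.1 + m.2 - a)

section
variable {u v i : ℕ}

/-- Since `i ≤ m.1`, the admissible distances start at `m.1 - i ≥ 0`, so none of the service length
is cut off at `0`. -/
lemma integral_meets_self {m : ℕ × ℕ} (hi : i ≤ m.1) (hu : m.1 ≤ u) (hv : m.2 ≤ v) :
    ∫ y in (0 : ℝ)..(u + v + 1), meets i i (y, m) = m.2 := by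
  have h1 : (i : ℝ) ≤ m.1 := by exact_mod_cast hi
  have h2 : (m.1 : ℝ) ≤ u := by exact_mod_cast hu
  have h3 : (m.2 : ℝ) ≤ v := by exact_mod_cast hv
  have h4 : (0 : ℝ) ≤ i := by positivity
  have h5 : (0 : ℝ) ≤ m.2 := by positivity
  rw [integral_meets (by positivity), min_eq_left (by linarith),
    max_eq_left (a := (m.1 : ℝ) - i) (by linarith), max_eq_left (by linarith)]
  ring

/-- A window of length `τ` adds at most `τ`. If `m.1 = i`, the truncation at distance `0` removes at
least `min (a - i) 1`; dividing by `R` bounds this below linearly on all of `[i, i + R]`. -/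
lemma integral_meets_le {m : ℕ × ℕ} (hi : i ≤ m.1) (h1 : 1 ≤ m.2) {a τ R : ℝ} (ha : i ≤ a)
    (hτ : 0 ≤ τ) (hR : 1 ≤ R) (haR : a ≤ i + R) :
    ∫ y in (0 : ℝ)..(u + v + 1), meets a (a + τ) (y, m)
      ≤ m.2 + τ - if m.1 = i then (a - i) / R else 0 := by
  have h2 : (i : ℝ) ≤ m.1 := by exact_mod_cast hi
  have h3 : (1 : ℝ) ≤ m.2 := by exact_mod_cast h1
  rw [integral_meets (by positivity)]
  have hR0 : 0 < R := by linarith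
  have h4 : (a - i) / R ≤ 1 := by rw [div_le_one hR0]; linarith
  have h5 : (a - i) / R ≤ a - i := div_le_self (by linarith) hR
  refine max_le ?_ ?_
  · have h6 := min_le_left ((m.1 : ℝ) + m.2 - a) (u + v + 1)
    have h7 := le_max_left ((m.1 : ℝ) - (a + τ)) 0
    have h8 := le_max_right ((m.1 : ℝ) - (a + τ)) 0
    split_ifs with h
    · rw [h] at h6 h8 ⊢
      linarith
    · linarith
  · split_ifs <;> linarith

lemma integral_meets_le_of_add_one_le {m : ℕ × ℕ} (h1 : 1 ≤ m.2) {a τ : ℝ}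
    (ha : (i : ℝ) + 1 ≤ a) (hτ : 0 ≤ τ) :
    ∫ y in (0 : ℝ)..(u + v + 1), meets a (a + τ) (y, m)
      ≤ m.2 + τ - if m.1 = i then 1 else 0 := by
  have h3 : (1 : ℝ) ≤ m.2 := by exact_mod_cast h1
  rw [integral_meets (by positivity)]
  have h6 := min_le_left ((m.1 : ℝ) + m.2 - a) (u + v + 1)
  have h7 := le_max_left ((m.1 : ℝ) - (a + τ)) 0
  have h8 := le_max_right ((m.1 : ℝ) - (a + τ)) 0
  refine max_le ?_ ?_
  · split_ifs with h
    · rw [h] at h6 h8 ⊢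
      linarith
    · linarith
  · split_ifs <;> linarith

lemma integral_indicator_Icc_le {L : ℝ} (hL : 0 ≤ L) {a b : ℝ} (hab : a ≤ b) :
    ∫ y in (0 : ℝ)..L, (Set.Icc a b).indicator (1 : ℝ → ℝ) y ≤ b - a := by
  rw [integral_indicator_Icc hL]
  exact max_le (sub_le_sub (min_le_left _ _) (le_max_left _ _)) (by linarith)

lemma intervalIntegrable_meets (a b c d : ℝ) (m : ℕ × ℕ) :
    IntervalIntegrable (fun y => meets a b (y, m)) volume c d :=
  intervalIntegrable_indicator_Icc ((m.1 : ℝ) - b) (m.1 + m.2 - a) c d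

lemma intervalIntegrable_sq_meets_sub {a τ : ℝ} (m : ℕ × ℕ) :
    IntervalIntegrable
      (fun y => (meets a (a + τ) (y, m) - meets i i (y, m)) ^ 2) volume 0 (u + v + 1) := by
  have h : ∀ y, (meets a (a + τ) (y, m) - meets i i (y, m)) ^ 2
      = meets a (a + τ) (y, m) + meets i i (y, m)
        - 2 * (meets i i (y, m) * meets a (a + τ) (y, m)) := by
    intro y
    rw [sub_sq, sq_meets, sq_meets]; ring
  simp only [h]
  refine ((intervalIntegrable_meets _ _ _ _ m).add (intervalIntegrable_meets _ _ _ _ m)).sub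
    (IntervalIntegrable.const_mul ?_ 2)
  refine (intervalIntegrable_const (c := (1 : ℝ))).mono_fun
    (((measurable_meets _ _).comp (by fun_prop)).mul
      ((measurable_meets _ _).comp (by fun_prop))).aestronglyMeasurable
    (Eventually.of_forall fun y => ?_)
  simp only [norm_one]
  rw [norm_mul, Real.norm_of_nonneg (meets_nonneg _ _ _),
    Real.norm_of_nonneg (meets_nonneg _ _ _)]
  exact mul_le_one₀ (meets_le_one _ _ _) (meets_nonneg _ _ _) (meets_le_one _ _ _)

lemma integral_sq_meets_sub_le {a τ : ℝ} (ha : i ≤ a) (hτ : 0 ≤ τ) (m : ℕ × ℕ) :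
    ∫ y in (0 : ℝ)..(u + v + 1), (meets a (a + τ) (y, m) - meets i i (y, m)) ^ 2
      ≤ 2 * (a - i + τ) := by
  have hL : (0 : ℝ) ≤ u + v + 1 := by positivity
  have h := intervalIntegral.integral_mono_on hL
    (intervalIntegrable_sq_meets_sub (a := a) (τ := τ) m)
    ((intervalIntegrable_indicator_Icc _ _ _ _).add (intervalIntegrable_indicator_Icc _ _ _ _))
    fun y _ => sq_meets_sub_meets_le ha (show (i : ℝ) ≤ a + τ by linarith) y m
  refine h.trans ?_
  rw [intervalIntegral.integral_add (intervalIntegrable_indicator_Icc _ _ _ _)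
    (intervalIntegrable_indicator_Icc _ _ _ _)]
  refine (add_le_add (integral_indicator_Icc_le hL (by linarith))
    (integral_indicator_Icc_le hL (by linarith))).trans ?_
  linarith

end

/-- Almost sure properties of the request of a customer. -/
def IsRequest (u v i : ℕ) (m : ℕ × ℕ) : Prop := i ≤ m.1 ∧ m.1 ≤ u ∧ 1 ≤ m.2 ∧ m.2 ≤ v

lemma pointSum_mono {M : Type*} {f g : ℝ × M → ℝ} (h : ∀ z, f z ≤ g z) (n : ℕ)
    (ω : ℕ → ℝ × M) : pointSum f n ω ≤ pointSum g n ω :=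
  Finset.sum_le_sum fun _ _ => h _

/-- A request made at distance `u + v + 1` or more ends before time `0`, so the first `n` customers
already account for every reservation at `r ≥ 0`. -/
lemma reservedCapacity_eq {u v i n : ℕ} {ω : Past} (hgap : ∀ k, 0 ≤ (ω k).1)
    (hreq : ∀ k, IsRequest u v i (ω k).2) (hn : (u : ℝ) + v + 1 ≤ elapsed ω n) {r : ℝ}
    (hr : 0 ≤ r) :
    (reservedCapacity ω r : ℝ≥0∞) = ENNReal.ofReal (pointSum (meets r r) n ω) := by
  classical
  have hmem : ∀ k, r ∈ reservedInterval ω k ↔ elapsed ω (k + 1) ∈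
      Set.Icc (((ω k).2.1 : ℝ) - r) ((ω k).2.1 + (ω k).2.2 - r) := by
    intro k
    have : arrivalTime ω k = -elapsed ω (k + 1) := rfl
    simp only [reservedInterval, Set.mem_Icc, this, reservationTime, serviceTime]
    constructor <;> rintro ⟨h1, h2⟩ <;> constructor <;> linarith
  have hset : {k : ℕ | r ∈ reservedInterval ω k}
      = ((Finset.range n).filter fun k => elapsed ω (k + 1) ∈
        Set.Icc (((ω k).2.1 : ℝ) - r) ((ω k).2.1 + (ω k).2.2 - r) : Finset ℕ) := by
    ext k
    simp only [Set.mem_ofPred_eq, hmem, Finset.coe_filter, Finset.mem_range]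
    refine ⟨fun h => ⟨?_, h⟩, fun h => h.2⟩
    by_contra hk
    have hmono : elapsed ω n ≤ elapsed ω (k + 1) :=
      Finset.sum_le_sum_of_subset_of_nonneg
        (Finset.range_subset_range.2 (by omega)) fun j _ _ => hgap j
    have h2 : ((ω k).2.1 : ℝ) ≤ u := by exact_mod_cast (hreq k).2.1
    have h3 : ((ω k).2.2 : ℝ) ≤ v := by exact_mod_cast (hreq k).2.2.2
    linarith [h.2]
  rw [reservedCapacity, hset, Set.encard_coe_eq_coe_finsetCard, ENat.toENNReal_coe]
  rw [← ENNReal.ofReal_natCast]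
  congr 1
  simp only [pointSum, meets, Set.indicator_apply, Pi.one_apply, Finset.sum_boole]

/-! ### Deviation estimates for the reservation counts -/

section
variable {u v i : ℕ} {p : PMF (ℕ × ℕ)}

lemma ae_isRequest (hD : ∀ d, reservationPMF p d ≠ 0 → d ≤ u)
    (hS : ∀ s, servicePMF p s ≠ 0 → 1 ≤ s ∧ s ≤ v)
    (hi : IsLeast {d : ℕ | 0 < reservationPMF p d} i) :
    ∀ᵐ m ∂p.toMeasure, IsRequest u v i m := by
  rw [← p.restrict_toMeasure_support, ae_restrict_iff' (.of_discrete)]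
  refine Eventually.of_forall fun m hm => ?_
  have h1 : reservationPMF p m.1 ≠ 0 :=
    (PMF.mem_support_iff _ _).1 ((PMF.mem_support_map_iff _ _ _).2 ⟨m, hm, rfl⟩)
  have h2 : servicePMF p m.2 ≠ 0 :=
    (PMF.mem_support_iff _ _).1 ((PMF.mem_support_map_iff _ _ _).2 ⟨m, hm, rfl⟩)
  exact ⟨hi.2 (pos_iff_ne_zero.2 h1), hD _ h1, (hS _ h2).1, (hS _ h2).2⟩

lemma integral_ite_reservation (i : ℕ) (c : ℝ) :
    ∫ m, (if m.1 = i then c else 0) ∂p.toMeasure = (reservationPMF p i).toReal * c := by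
  have h : (fun m : ℕ × ℕ => if m.1 = i then c else 0)
      = (Prod.fst ⁻¹' {i}).indicator fun _ => c := by
    funext m
    by_cases hm : m.1 = i
    · rw [if_pos hm, Set.indicator_of_mem (by exact hm)]
    · rw [if_neg hm, Set.indicator_of_notMem (by exact hm)]
  rw [h, integral_indicator_const _ (.of_discrete), smul_eq_mul, measureReal_def,
    ← PMF.toMeasure_map_apply Prod.fst p {i} measurable_fst (.of_discrete),
    PMF.toMeasure_apply_singleton _ _ (.of_discrete), reservationPMF]

lemma integrable_service (hp : ∀ᵐ m ∂p.toMeasure, IsRequest u v i m) :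
    Integrable (fun m : ℕ × ℕ => (m.2 : ℝ)) p.toMeasure := by
  refine Integrable.of_bound (Measurable.of_discrete).aestronglyMeasurable v ?_
  filter_upwards [hp] with m hm
  rw [Real.norm_of_nonneg (by positivity)]
  exact_mod_cast hm.2.2.2

lemma trafficIntensity_eq (hp : ∀ᵐ m ∂p.toMeasure, IsRequest u v i m)
    (hS : ∀ s, servicePMF p s ≠ 0 → 1 ≤ s ∧ s ≤ v) (lam : ℝ) :
    trafficIntensity p v lam = (∫ m, (m.2 : ℝ) ∂p.toMeasure) * lam := by
  have h1 : ∫ m, (m.2 : ℝ) ∂p.toMeasure = ∫ s, (s : ℝ) ∂(servicePMF p).toMeasure := by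
    rw [servicePMF, ← PMF.toMeasure_map Prod.snd p measurable_snd,
      integral_map measurable_snd.aemeasurable (Measurable.of_discrete).aestronglyMeasurable]
  have hint : Integrable (fun s : ℕ => (s : ℝ)) (servicePMF p).toMeasure := by
    rw [servicePMF, ← PMF.toMeasure_map Prod.snd p measurable_snd,
      integrable_map_measure (Measurable.of_discrete).aestronglyMeasurable
        measurable_snd.aemeasurable]
    exact integrable_service hp
  rw [h1, PMF.integral_eq_tsum _ _ hint, tsum_eq_sum (s := Finset.Icc 1 v), trafficIntensity,
    Finset.sum_mul]
  · refine Finset.sum_congr rfl fun s _ => ?_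
    rw [smul_eq_mul]
    ring
  · intro s hs
    have : servicePMF p s = 0 := by
      by_contra h
      exact hs (Finset.mem_Icc.2 (hS s h))
    simp [this]

lemma integral_service_pos (hp : ∀ᵐ m ∂p.toMeasure, IsRequest u v i m) :
    1 ≤ ∫ m, (m.2 : ℝ) ∂p.toMeasure := by
  have h : ∫ _, (1 : ℝ) ∂p.toMeasure ≤ ∫ m, (m.2 : ℝ) ∂p.toMeasure := by
    refine integral_mono_ae (integrable_const _) (integrable_service hp) ?_
    filter_upwards [hp] with m hm
    exact_mod_cast hm.2.2.1
  simpa using h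

lemma integral_service_le (hp : ∀ᵐ m ∂p.toMeasure, IsRequest u v i m) :
    ∫ m, (m.2 : ℝ) ∂p.toMeasure ≤ v := by
  have h : ∫ m, (m.2 : ℝ) ∂p.toMeasure ≤ ∫ _, (v : ℝ) ∂p.toMeasure := by
    refine integral_mono_ae (integrable_service hp) (integrable_const _) ?_
    filter_upwards [hp] with m hm
    exact_mod_cast hm.2.2.2
  simpa using h

lemma integrable_ite_reservation (i : ℕ) (c : ℝ) :
    Integrable (fun m : ℕ × ℕ => if m.1 = i then c else 0) p.toMeasure := by
  refine Integrable.of_bound (Measurable.of_discrete).aestronglyMeasurable |c|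
    (Eventually.of_forall fun m => ?_)
  split_ifs <;> simp

lemma toReal_reservationPMF_le_one (i : ℕ) : (reservationPMF p i).toReal ≤ 1 :=
  ENNReal.toReal_le_of_le_ofReal zero_le_one (by simpa using PMF.coe_le_one _ _)

lemma isProbabilityMeasure_pastLaw (p : PMF (ℕ × ℕ)) {lam : ℝ} (hlam : 0 < lam) :
    IsProbabilityMeasure (pastLaw p lam) := by
  have := isProbabilityMeasure_expMeasure hlam
  unfold pastLaw
  infer_instance

/-- A short window after `i` rarely sees many more reservations than time `i` itself. -/
theorem measureReal_add_le_pointSum_meets_le (hp : ∀ᵐ m ∂p.toMeasure, IsRequest u v i m)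
    {lam : ℝ} (hlam : 1 ≤ lam) {R a : ℝ} (hR : 1 ≤ R) (ha : (i : ℝ) ≤ a) (haR : a ≤ i + R)
    (n : ℕ) (x : ℝ) :
    (pastLaw p lam).real {ω | (pointSum (meets i i) n ω + x ≤ pointSum (meets a (a + 1 / lam)) n ω)
        ∧ (u : ℝ) + v + 1 ≤ elapsed ω n}
      ≤ Real.exp (3 - (reservationPMF p i).toReal / (4 * R) * x) := by
  set γ := (reservationPMF p i).toReal with hγ
  have hγ0 : 0 ≤ γ := ENNReal.toReal_nonneg
  have hγ1 : γ ≤ 1 := toReal_reservationPMF_le_one i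
  -- Chosen so that the drift gain `θ γ (a - i) / R = 4 θ ^ 2 (a - i)` is twice the second-order
  -- cost `2 θ ^ 2 (a - i)`. What remains comes from the window width, where `lam * τ = 1`, and is
  -- at most `θ + 2 θ ^ 2 ≤ 3`.
  set θ := γ / (4 * R) with hθ
  have hθ0 : 0 ≤ θ := by positivity
  have hθ1 : θ ≤ 1 := by
    rw [hθ, div_le_one (by positivity)]; linarith
  have hlam0 : 0 < lam := by linarith
  have hR0 : 0 < R := by linarith
  set τ := 1 / lam with hτ
  have hτ0 : 0 ≤ τ := by positivity
  set f : ℝ × (ℕ × ℕ) → ℝ := fun z => θ * (meets a (a + τ) z - meets i i z) with hf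
  have hfm : Measurable f := ((measurable_meets _ _).sub (measurable_meets _ _)).const_mul θ
  have hfb : ∀ z, |f z| ≤ 1 := by
    intro z
    rw [hf, abs_mul, abs_of_nonneg hθ0]
    refine mul_le_one₀ hθ1 (abs_nonneg _) (abs_le.2 ⟨?_, ?_⟩)
    · linarith [meets_nonneg a (a + τ) z, meets_le_one i i z]
    · linarith [meets_le_one a (a + τ) z, meets_nonneg i i z]
  have hi0 : (0 : ℝ) ≤ i := by positivity
  have hfL : ∀ y, (u : ℝ) + v + 1 ≤ y → ∀ᵐ m ∂p.toMeasure, f (y, m) = 0 := by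
    intro y hy
    filter_upwards [hp] with m hm
    simp [hf, meets_eq_zero (hi0.trans ha) hy hm.2.1 hm.2.2.2,
      meets_eq_zero hi0 hy hm.2.1 hm.2.2.2]
  have hc : ∀ y, y ∉ meetsJumps a (a + τ) ∪ meetsJumps i i → ∀ m,
      ContinuousAt (fun y => f (y, m)) y := fun y hy m =>
    continuousAt_const.mul ((continuousAt_meets (fun h => hy (Or.inl h)) m).sub
      (continuousAt_meets (fun h => hy (Or.inr h)) m))
  set G : ℕ × ℕ → ℝ := fun m =>
    θ * (τ - if m.1 = i then (a - i) / R else 0) + θ ^ 2 * (2 * (a - i + τ)) with hG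
  have hint := integrable_ite_reservation (p := p) i ((a - i) / R)
  have hdi : Integrable (fun m : ℕ × ℕ => τ - if m.1 = i then (a - i) / R else 0) p.toMeasure :=
    (integrable_const τ).sub hint
  have hGi : Integrable G p.toMeasure := (hdi.const_mul θ).add (integrable_const _)
  have hGv : ∫ m, G m ∂p.toMeasure
      = θ * (τ - γ * ((a - i) / R)) + θ ^ 2 * (2 * (a - i + τ)) := by
    simp only [hG]
    rw [integral_add (hdi.const_mul θ) (integrable_const _),
      integral_const_mul, integral_sub (integrable_const τ) hint, integral_ite_reservation]
    simp [hγ]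
  have hfG : ∀ᵐ m ∂p.toMeasure,
      ∫ y in (0 : ℝ)..(u + v + 1), (f (y, m) + f (y, m) ^ 2) ≤ G m := by
    filter_upwards [hp] with m hm
    have hi1 := intervalIntegrable_meets a (a + τ) 0 (u + v + 1) m
    have hi2 := intervalIntegrable_meets i i 0 (u + v + 1) m
    have h0 : ∀ y, f (y, m) + f (y, m) ^ 2 = θ * (meets a (a + τ) (y, m) - meets i i (y, m))
        + θ ^ 2 * (meets a (a + τ) (y, m) - meets i i (y, m)) ^ 2 := by
      intro y; simp only [hf]; ring
    have hsq := intervalIntegrable_sq_meets_sub (u := u) (v := v) (i := i) (a := a) (τ := τ) m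
    simp only [h0]
    rw [intervalIntegral.integral_add ((hi1.sub hi2).const_mul θ) (hsq.const_mul _),
      intervalIntegral.integral_const_mul, intervalIntegral.integral_const_mul,
      intervalIntegral.integral_sub hi1 hi2, integral_meets_self hm.1 hm.2.1 hm.2.2.2]
    refine add_le_add (mul_le_mul_of_nonneg_left ?_ hθ0)
      (mul_le_mul_of_nonneg_left (integral_sq_meets_sub_le ha hτ0 m) (sq_nonneg θ))
    linarith [integral_meets_le (u := u) (v := v) hm.1 hm.2.2.1 ha hτ0 hR haR]
  have key := measureReal_le_pointSum_le_of_integral_le (μ := p.toMeasure) hlam0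
    (by positivity) hfm hfb hfL
    ((countable_meetsJumps a (a + τ)).union (countable_meetsJumps i i)) hc n (θ * x) hGi hfG
  have := isProbabilityMeasure_pastLaw p hlam0
  refine (measureReal_mono ?_).trans (key.trans (Real.exp_le_exp.2 ?_))
  · rintro ω ⟨h1, h2⟩
    refine ⟨?_, h2⟩
    have : pointSum f n ω
        = θ * (pointSum (meets a (a + τ)) n ω - pointSum (meets i i) n ω) := by
      simp only [pointSum, hf]
      rw [← Finset.mul_sum, Finset.sum_sub_distrib]
    rw [this]
    exact mul_le_mul_of_nonneg_left (by linarith) hθ0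
  · rw [hGv]
    have hlt : lam * τ = 1 := by rw [hτ]; field_simp
    have h1 : θ * γ * ((a - i) / R) = 4 * θ ^ 2 * (a - i) := by
      rw [hθ]; field_simp
    have h2 : lam * (θ * (τ - γ * ((a - i) / R)) + θ ^ 2 * (2 * (a - i + τ)))
        = θ * (lam * τ) + 2 * θ ^ 2 * (lam * τ) - 2 * θ ^ 2 * (lam * (a - i)) := by
      linear_combination (-lam) * h1
    rw [h2, hlt]
    have h3 : 0 ≤ 2 * θ ^ 2 * (lam * (a - i)) := by
      have : 0 ≤ a - i := by linarith
      positivity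
    have h4 : θ ^ 2 ≤ 1 := pow_le_one₀ hθ0 hθ1
    linarith

/-- A short window at distance at least one from `i` rarely sees `ρ` reservations. -/
theorem measureReal_le_pointSum_meets_le (hp : ∀ᵐ m ∂p.toMeasure, IsRequest u v i m)
    {lam : ℝ} (hlam : 1 ≤ lam) {a : ℝ} (ha : (i : ℝ) + 1 ≤ a) (n : ℕ) :
    (pastLaw p lam).real {ω | (∫ m, (m.2 : ℝ) ∂p.toMeasure) * lam
          ≤ pointSum (meets a (a + 1 / lam)) n ω ∧ (u : ℝ) + v + 1 ≤ elapsed ω n}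
      ≤ Real.exp (2 - (reservationPMF p i).toReal ^ 2 / (4 * v) * lam) := by
  set γ := (reservationPMF p i).toReal with hγ
  set e := ∫ m, (m.2 : ℝ) ∂p.toMeasure with he
  have he1 : 1 ≤ e := integral_service_pos hp
  have hev : e ≤ v := integral_service_le hp
  have hγ0 : 0 ≤ γ := ENNReal.toReal_nonneg
  have hγ1 : γ ≤ 1 := toReal_reservationPMF_le_one i
  have hv1 : (1 : ℝ) ≤ v := he1.trans hev
  -- With `e ≤ v` the second-order cost `θ ^ 2 e` is at most half of the gain `θ γ`; the other half
  -- gives the exponent `γ ^ 2 / (4 v)`.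
  set θ := γ / (2 * v) with hθ
  have hθ0 : 0 ≤ θ := by positivity
  have hθ1 : θ ≤ 1 := by
    rw [hθ, div_le_one (by positivity)]; linarith
  have hlam0 : 0 < lam := by linarith
  set τ := 1 / lam with hτ
  have hτ0 : 0 ≤ τ := by positivity
  set f : ℝ × (ℕ × ℕ) → ℝ := fun z => θ * meets a (a + τ) z with hf
  have hfm : Measurable f := (measurable_meets _ _).const_mul θ
  have hfb : ∀ z, |f z| ≤ 1 := by
    intro z
    rw [hf, abs_mul, abs_of_nonneg hθ0, abs_of_nonneg (meets_nonneg _ _ _)]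
    exact mul_le_one₀ hθ1 (meets_nonneg _ _ _) (meets_le_one _ _ _)
  have ha0 : 0 ≤ a := le_trans (by positivity) ha
  have hfL : ∀ y, (u : ℝ) + v + 1 ≤ y → ∀ᵐ m ∂p.toMeasure, f (y, m) = 0 := by
    intro y hy
    filter_upwards [hp] with m hm
    simp [hf, meets_eq_zero ha0 hy hm.2.1 hm.2.2.2]
  have hc : ∀ y, y ∉ meetsJumps a (a + τ) → ∀ m, ContinuousAt (fun y => f (y, m)) y :=
    fun y hy m => continuousAt_const.mul (continuousAt_meets hy m)
  set G : ℕ × ℕ → ℝ := fun m => (θ + θ ^ 2) * (m.2 + τ - if m.1 = i then 1 else 0) with hG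
  have hint := integrable_ite_reservation (p := p) i 1
  have hsi : Integrable (fun m : ℕ × ℕ => (m.2 : ℝ) + τ) p.toMeasure :=
    (integrable_service hp).add (integrable_const τ)
  have hGi : Integrable G p.toMeasure := (hsi.sub hint).const_mul _
  have hGv : ∫ m, G m ∂p.toMeasure = (θ + θ ^ 2) * (e + τ - γ) := by
    rw [hG, integral_const_mul, integral_sub hsi hint, integral_ite_reservation,
      integral_add (integrable_service hp) (integrable_const τ)]
    simp [hγ, he]
  have hfG : ∀ᵐ m ∂p.toMeasure,
      ∫ y in (0 : ℝ)..(u + v + 1), (f (y, m) + f (y, m) ^ 2) ≤ G m := by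
    filter_upwards [hp] with m hm
    have h0 : ∀ y, f (y, m) + f (y, m) ^ 2 = (θ + θ ^ 2) * meets a (a + τ) (y, m) := by
      intro y; simp only [hf]; rw [mul_pow, sq_meets]; ring
    simp only [h0]
    rw [intervalIntegral.integral_const_mul]
    exact mul_le_mul_of_nonneg_left (integral_meets_le_of_add_one_le hm.2.2.1 ha hτ0)
      (by positivity)
  have key := measureReal_le_pointSum_le_of_integral_le (μ := p.toMeasure) hlam0
    (by positivity) hfm hfb hfL (countable_meetsJumps a (a + τ)) hc n (θ * (e * lam)) hGi hfG
  have := isProbabilityMeasure_pastLaw p hlam0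
  refine (measureReal_mono ?_).trans (key.trans (Real.exp_le_exp.2 ?_))
  · rintro ω ⟨h1, h2⟩
    refine ⟨?_, h2⟩
    have : pointSum f n ω = θ * pointSum (meets a (a + τ)) n ω := by
      simp only [pointSum, hf]
      rw [← Finset.mul_sum]
    rw [this]
    exact mul_le_mul_of_nonneg_left h1 hθ0
  · rw [hGv]
    have hlt : lam * τ = 1 := by rw [hτ]; field_simp
    have h1 : γ ^ 2 / (4 * v) = θ * γ / 2 := by
      rw [hθ]; field_simp; ring
    have h2 : θ * v = γ / 2 := by
      rw [hθ]; field_simp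
    have h3 : θ ^ 2 * e ≤ θ * γ / 2 := by
      calc θ ^ 2 * e ≤ θ ^ 2 * v := mul_le_mul_of_nonneg_left hev (sq_nonneg θ)
        _ = θ * γ / 2 := by linear_combination θ * h2
    have h4 : θ ^ 2 ≤ 1 := pow_le_one₀ hθ0 hθ1
    have h5 : -(θ * (e * lam)) + lam * ((θ + θ ^ 2) * (e + τ - γ))
        = (θ + θ ^ 2) * (lam * τ) + lam * (θ ^ 2 * e) - lam * (θ * γ) - lam * (θ ^ 2 * γ) := by
      ring
    have h6 : 0 ≤ lam * (θ ^ 2 * γ) := by positivity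
    have h7 := mul_le_mul_of_nonneg_left h3 hlam0.le
    rw [h5, h1, hlt]
    linarith

/-- The number of reservations for time `i` is asymptotically Poisson. -/
theorem norm_integral_cexp_pointSum_meets_sub_le
    (hp : ∀ᵐ m ∂p.toMeasure, IsRequest u v i m) {lam : ℝ} (hlam : 0 < lam) (n : ℕ) (s : ℝ) :
    ‖∫ ω, Complex.exp ((s * pointSum (meets i i) n ω : ℝ) * Complex.I) ∂(pastLaw p lam)
      - Complex.exp (((∫ m, (m.2 : ℝ) ∂p.toMeasure) * lam : ℝ)
          * (Complex.exp (s * Complex.I) - 1))‖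
      ≤ (1 + Real.exp (lam * (2 * (u + v + 1))))
        * (pastLaw p lam).real {ω | elapsed ω n < u + v + 1} := by
  have hL : (0 : ℝ) ≤ u + v + 1 := by positivity
  have hi0 : (0 : ℝ) ≤ i := by positivity
  have key := norm_integral_cexp_pointSum_sub_le (μ := p.toMeasure) hlam hL
    (measurable_meets i i) (fun y hy => by
      filter_upwards [hp] with m hm using meets_eq_zero hi0 hy hm.2.1 hm.2.2.2)
    (countable_meetsJumps i i) (fun y hy m => continuousAt_meets hy m) n s
  have hexp : ∀ y, (∫ m, Complex.exp ((s * meets i i (y, m) : ℝ) * Complex.I) ∂p.toMeasure) - 1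
      = ((∫ m, meets i i (y, m) ∂p.toMeasure : ℝ) : ℂ) * (Complex.exp (s * Complex.I) - 1) := by
    intro y
    -- As `meets` takes only the values `0` and `1`, the exponential is affine in it; this produces
    -- the Poisson form.
    have hpt : ∀ m, Complex.exp ((s * meets i i (y, m) : ℝ) * Complex.I)
        = ((meets i i (y, m) : ℝ) : ℂ) * (Complex.exp (s * Complex.I) - 1) + 1 := by
      intro m
      rcases Set.indicator_eq_zero_or_self (Set.Icc ((m.1 : ℝ) - i) (m.1 + m.2 - i))
        (1 : ℝ → ℝ) y with h | h
      · have h' : meets i i (y, m) = 0 := h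
        simp [h']
      · have h' : meets i i (y, m) = 1 := h
        simp [h']
    have hmi : Integrable (fun m => ((meets i i (y, m) : ℝ) : ℂ)) p.toMeasure :=
      Integrable.of_bound (Measurable.of_discrete).aestronglyMeasurable 1
        (Eventually.of_forall fun m => by
          rw [Complex.norm_real, Real.norm_of_nonneg (meets_nonneg _ _ _)]
          exact meets_le_one _ _ _)
    simp only [hpt]
    rw [integral_add (hmi.mul_const _) (integrable_const _), integral_mul_const,
      integral_complex_ofReal]
    simp
  have hswap : ∫ y in (0 : ℝ)..(u + v + 1), ∫ m, meets i i (y, m) ∂p.toMeasure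
      = ∫ m, (m.2 : ℝ) ∂p.toMeasure := by
    have h : ∫ m, (m.2 : ℝ) ∂p.toMeasure
        = ∫ m, (∫ y in (0 : ℝ)..(u + v + 1), meets i i (y, m)) ∂p.toMeasure := by
      refine integral_congr_ae ?_
      filter_upwards [hp] with m hm
      exact (integral_meets_self hm.1 hm.2.1 hm.2.2.2).symm
    rw [h]
    simp only [intervalIntegral.integral_of_le hL]
    refine integral_integral_swap (f := fun y m => meets i i (y, m)) ?_
    refine Integrable.of_bound (measurable_meets i i).aestronglyMeasurable 1
      (Eventually.of_forall fun z => ?_)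
    exact (Real.norm_of_nonneg (meets_nonneg i i z)).trans_le (meets_le_one i i z)
  have hval : (lam : ℂ) * ∫ y in (0 : ℝ)..(u + v + 1),
      ((∫ m, Complex.exp ((s * meets i i (y, m) : ℝ) * Complex.I) ∂p.toMeasure) - 1)
      = ((∫ m, (m.2 : ℝ) ∂p.toMeasure) * lam : ℝ) * (Complex.exp (s * Complex.I) - 1) := by
    simp only [hexp]
    rw [intervalIntegral.integral_mul_const, intervalIntegral.integral_ofReal, hswap]
    push_cast
    ring
  rw [hval] at key
  exact key

end

/-! ### Covering by short windows and passage to the limit -/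

lemma exists_mem_window {r₀ R τ r : ℝ} (hτ : 0 < τ) (hr : r ∈ Set.Icc r₀ (r₀ + R)) :
    ∃ k ∈ Finset.range (⌊R / τ⌋₊ + 1), r₀ + k * τ ≤ r₀ + R
      ∧ r ∈ Set.Icc (r₀ + k * τ) (r₀ + k * τ + τ) := by
  have h0 : 0 ≤ (r - r₀) / τ := div_nonneg (by linarith [hr.1]) hτ.le
  have h1 := Nat.floor_le h0
  have h2 := Nat.lt_floor_add_one ((r - r₀) / τ)
  rw [le_div_iff₀ hτ] at h1
  rw [div_lt_iff₀ hτ] at h2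
  refine ⟨⌊(r - r₀) / τ⌋₊, ?_, by linarith [hr.2], by linarith, by linarith⟩
  rw [Finset.mem_range, Nat.lt_succ_iff]
  exact Nat.floor_le_floor (div_le_div_of_nonneg_right (by linarith [hr.2]) hτ.le)

lemma tendsto_pow_add_one_mul_exp (m : ℕ) (A B : ℝ) {c : ℝ} (hc : 0 < c) :
    Tendsto (fun y : ℝ => (A * y ^ m + 1) * Real.exp (B - c * y)) atTop (𝓝 0) := by
  have hcy : Tendsto (fun y : ℝ => c * y) atTop atTop := tendsto_id.const_mul_atTop hc
  have h1 := ((Real.tendsto_pow_mul_exp_neg_atTop_nhds_zero m).comp hcy).const_mul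
    (A / c ^ m * Real.exp B)
  have h2 := ((Real.tendsto_exp_neg_atTop_nhds_zero).comp hcy).const_mul (Real.exp B)
  have h3 := h1.add h2
  simp only [mul_zero, add_zero] at h3
  refine h3.congr fun y => ?_
  simp only [Function.comp_def]
  rw [sub_eq_add_neg, Real.exp_add, mul_pow]
  field_simp

section
variable {u v i : ℕ} {p : PMF (ℕ × ℕ)}

lemma ae_past (hp : ∀ᵐ m ∂p.toMeasure, IsRequest u v i m) {lam : ℝ} (hlam : 0 < lam) :
    ∀ᵐ ω ∂(pastLaw p lam), (∀ k, 0 ≤ (ω k).1) ∧ ∀ k, IsRequest u v i (ω k).2 := by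
  have := isProbabilityMeasure_expMeasure hlam
  have hν : ∀ᵐ z ∂((expMeasure lam).prod p.toMeasure), 0 ≤ z.1 ∧ IsRequest u v i z.2 :=
    (Measure.quasiMeasurePreserving_fst.ae (ae_expMeasure_nonneg lam)).and
      (Measure.quasiMeasurePreserving_snd.ae hp)
  have h : ∀ k, ∀ᵐ ω ∂(pastLaw p lam), 0 ≤ (ω k).1 ∧ IsRequest u v i (ω k).2 := fun k =>
    (measurePreserving_eval_infinitePi
      (fun _ : ℕ => (expMeasure lam).prod p.toMeasure) k).quasiMeasurePreserving.ae hν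
  filter_upwards [ae_all_iff.2 h] with ω hω
  exact ⟨fun k => (hω k).1, fun k => (hω k).2⟩

lemma mem_virtuallyBlocked_iff {n : ℕ} {ω : Past} (hgap : ∀ k, 0 ≤ (ω k).1)
    (hreq : ∀ k, IsRequest u v i (ω k).2) (hn : (u : ℝ) + v + 1 ≤ elapsed ω n) {C : ℝ}
    {d s : ℕ} :
    ω ∈ virtuallyBlocked C d s
      ↔ ∃ r ∈ Set.Icc (d : ℝ) (d + s), C ≤ pointSum (meets r r) n ω := by
  refine exists_congr fun r => and_congr_right fun hr => ?_
  have hr0 : 0 ≤ r := le_trans (by positivity) hr.1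
  rw [reservedCapacity_eq hgap hreq hn hr0, ENNReal.ofReal_le_ofReal_iff]
  exact Finset.sum_nonneg fun k _ => meets_nonneg _ _ _

/-- Union bound shared by both limits. Only monotonicity and subadditivity of the measure are used,
so the blocking event, a union over uncountably many times, need not be shown measurable. -/
lemma virtualBlockingProb_le (hp : ∀ᵐ m ∂p.toMeasure, IsRequest u v i m) {lam : ℝ}
    (hlam : 0 < lam) (n : ℕ) {C : ℝ} {d s : ℕ} {E : Set Past} {N : ℕ} {F : ℕ → Set Past} {b : ℝ}
    (hF : ∀ k ∈ Finset.range N, (pastLaw p lam).real (F k) ≤ b)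
    (hsub : ∀ ω, (u : ℝ) + v + 1 ≤ elapsed ω n → ∀ r ∈ Set.Icc (d : ℝ) (d + s),
      C ≤ pointSum (meets r r) n ω → ω ∈ E ∨ ∃ k ∈ Finset.range N, ω ∈ F k) :
    virtualBlockingProb p lam C d s
      ≤ (pastLaw p lam).real {ω | elapsed ω n < u + v + 1} + (pastLaw p lam).real E + N * b := by
  have := isProbabilityMeasure_pastLaw p hlam
  have hle : virtualBlockingProb p lam C d s ≤ (pastLaw p lam).real
      ({ω | elapsed ω n < u + v + 1} ∪ E ∪ ⋃ k ∈ Finset.range N, F k) := by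
    refine ENNReal.toReal_mono (measure_ne_top _ _) (measure_mono_ae ?_)
    filter_upwards [ae_past hp hlam] with ω hω hb
    rcases lt_or_ge (elapsed ω n) (u + v + 1) with h | h
    · exact Or.inl (Or.inl h)
    · obtain ⟨r, hr, hC⟩ := (mem_virtuallyBlocked_iff hω.1 hω.2 h).1 hb
      rcases hsub ω h r hr hC with hE | ⟨k, hk, hFk⟩
      · exact Or.inl (Or.inr hE)
      · exact Or.inr (Set.mem_biUnion hk hFk)
  have h1 := measureReal_union_le (μ := pastLaw p lam)
    ({ω | elapsed ω n < u + v + 1} ∪ E) (⋃ k ∈ Finset.range N, F k)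
  have h2 := measureReal_union_le (μ := pastLaw p lam) {ω : Past | elapsed ω n < u + v + 1} E
  have h3 := measureReal_biUnion_finset_le (μ := pastLaw p lam) (Finset.range N) F
  have h4 := Finset.sum_le_card_nsmul (Finset.range N) _ b hF
  rw [Finset.card_range, nsmul_eq_mul] at h4
  linarith

lemma floor_div_inv_add_one_le {R lam : ℝ} (hR : 0 ≤ R) (hlam : 0 < lam) :
    ((⌊R / (1 / lam)⌋₊ + 1 : ℕ) : ℝ) ≤ R * lam + 1 := by
  have h : 0 ≤ R / (1 / lam) := by positivity
  have := Nat.floor_le h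
  push_cast
  rw [div_div_eq_mul_div, div_one] at *
  linarith

/-- Blocking forces either a count at `i` within `x` of `C`, or a window exceeding the count at `i`
by `x`; the second is paid for by about `s * lam` windows of length `1 / lam`. -/
lemma virtualBlockingProb_le_of_eq (hp : ∀ᵐ m ∂p.toMeasure, IsRequest u v i m) {lam : ℝ}
    (hlam : 1 ≤ lam) (n : ℕ) {s : ℕ} (hs : 1 ≤ s) (C x : ℝ) :
    virtualBlockingProb p lam C i s
      ≤ (pastLaw p lam).real {ω | elapsed ω n < u + v + 1}
        + (pastLaw p lam).real {ω | C - x ≤ pointSum (meets i i) n ω}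
        + (s * lam + 1) * Real.exp (3 - (reservationPMF p i).toReal / (4 * s) * x) := by
  have hlam0 : 0 < lam := by linarith
  have hs1 : (1 : ℝ) ≤ s := by exact_mod_cast hs
  have hb := virtualBlockingProb_le hp hlam0 n (C := C) (d := i) (s := s)
    (E := {ω | C - x ≤ pointSum (meets i i) n ω}) (N := ⌊(s : ℝ) / (1 / lam)⌋₊ + 1)
    (F := fun k => {ω | (i : ℝ) + k * (1 / lam) ≤ i + s ∧
      pointSum (meets i i) n ω + x
        ≤ pointSum (meets (i + k * (1 / lam)) (i + k * (1 / lam) + 1 / lam)) n ω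
        ∧ (u : ℝ) + v + 1 ≤ elapsed ω n})
    (b := Real.exp (3 - (reservationPMF p i).toReal / (4 * s) * x)) ?_ ?_
  · refine hb.trans (add_le_add_right (mul_le_mul_of_nonneg_right ?_ (Real.exp_pos _).le) _)
    exact floor_div_inv_add_one_le (by linarith) hlam0
  · intro k _
    -- The guard in `F` makes the event empty when the window starts beyond `i + s`, so the
    -- deviation bound is needed only with `R = s`.
    by_cases hk : (i : ℝ) + k * (1 / lam) ≤ i + s
    · simp only [hk, true_and]
      exact measureReal_add_le_pointSum_meets_le hp hlam hs1
        (le_add_of_nonneg_right (by positivity)) hk n x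
    · simp only [hk, false_and]
      simpa using (Real.exp_pos _).le
  · intro ω hω r hr hC
    by_cases hE : C - x ≤ pointSum (meets i i) n ω
    · exact Or.inl hE
    · obtain ⟨k, hk, hki, hkr⟩ := exists_mem_window (τ := 1 / lam) (by positivity) hr
      refine Or.inr ⟨k, hk, hki, ?_, hω⟩
      have := pointSum_mono (meets_mono hkr.1 hkr.2) n ω
      linarith

lemma virtualBlockingProb_le_of_lt (hp : ∀ᵐ m ∂p.toMeasure, IsRequest u v i m) {lam : ℝ}
    (hlam : 1 ≤ lam) (n : ℕ) {d s : ℕ} (hd : i + 1 ≤ d) :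
    virtualBlockingProb p lam ((∫ m, (m.2 : ℝ) ∂p.toMeasure) * lam) d s
      ≤ (pastLaw p lam).real {ω | elapsed ω n < u + v + 1}
        + (s * lam + 1) * Real.exp (2 - (reservationPMF p i).toReal ^ 2 / (4 * v) * lam) := by
  have hlam0 : 0 < lam := by linarith
  have hd1 : (i : ℝ) + 1 ≤ d := by exact_mod_cast hd
  have hb := virtualBlockingProb_le hp hlam0 n (C := (∫ m, (m.2 : ℝ) ∂p.toMeasure) * lam) (d := d)
    (s := s) (E := ∅) (N := ⌊(s : ℝ) / (1 / lam)⌋₊ + 1)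
    (F := fun k => {ω | (∫ m, (m.2 : ℝ) ∂p.toMeasure) * lam
        ≤ pointSum (meets (d + k * (1 / lam)) (d + k * (1 / lam) + 1 / lam)) n ω
        ∧ (u : ℝ) + v + 1 ≤ elapsed ω n})
    (b := Real.exp (2 - (reservationPMF p i).toReal ^ 2 / (4 * v) * lam)) ?_ ?_
  · rw [measureReal_empty, add_zero] at hb
    refine hb.trans (add_le_add_right (mul_le_mul_of_nonneg_right ?_ (Real.exp_pos _).le) _)
    exact floor_div_inv_add_one_le (by positivity) hlam0
  · intro k _
    exact measureReal_le_pointSum_meets_le hp hlam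
      (hd1.trans (le_add_of_nonneg_right (by positivity))) n
  · intro ω hω r hr hC
    obtain ⟨k, hk, _, hkr⟩ := exists_mem_window (τ := 1 / lam) (by positivity) hr
    exact Or.inr ⟨k, hk, hC.trans (pointSum_mono (meets_mono hkr.1 hkr.2) n ω), hω⟩

lemma le_virtualBlockingProb (hp : ∀ᵐ m ∂p.toMeasure, IsRequest u v i m) {lam : ℝ}
    (hlam : 0 < lam) (n : ℕ) (s : ℕ) (C : ℝ) :
    (pastLaw p lam).real {ω | C ≤ pointSum (meets i i) n ω}
      ≤ virtualBlockingProb p lam C i s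
        + (pastLaw p lam).real {ω | elapsed ω n < u + v + 1} := by
  have := isProbabilityMeasure_pastLaw p hlam
  refine le_trans ?_ (measureReal_union_le _ _)
  refine ENNReal.toReal_mono (measure_ne_top _ _) (measure_mono_ae ?_)
  filter_upwards [ae_past hp hlam] with ω hω hC
  rcases lt_or_ge (elapsed ω n) (u + v + 1) with h | h
  · exact Or.inr h
  · exact Or.inl ((mem_virtuallyBlocked_iff hω.1 hω.2 h).2
      ⟨i, ⟨le_rfl, le_add_of_nonneg_right (by positivity)⟩, hC⟩)

/-- The limits of the virtual blocking probabilities along a sequence of arrival rates. -/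
theorem tendsto_virtualBlockingProb_seq (hp : ∀ᵐ m ∂p.toMeasure, IsRequest u v i m)
    (hγ : 0 < (reservationPMF p i).toReal) {lam : ℕ → ℝ} (hlam1 : ∀ k, 1 ≤ lam k)
    (hlam : Tendsto lam atTop atTop) {s : ℕ} (hs : 1 ≤ s) :
    Tendsto (fun k => virtualBlockingProb p (lam k) ((∫ m, (m.2 : ℝ) ∂p.toMeasure) * lam k) i s)
        atTop (𝓝 (1 / 2)) ∧
      ∀ d : ℕ, i + 1 ≤ d → Tendsto (fun k => virtualBlockingProb p (lam k)
        ((∫ m, (m.2 : ℝ) ∂p.toMeasure) * lam k) d s) atTop (𝓝 0) := by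
  set e := ∫ m, (m.2 : ℝ) ∂p.toMeasure with he
  have he1 : 1 ≤ e := integral_service_pos hp
  have hv : (1 : ℝ) ≤ v := he1.trans (integral_service_le hp)
  have hs1 : (1 : ℝ) ≤ s := by exact_mod_cast hs
  have hlam0 : ∀ k, 0 < lam k := fun k => by linarith [hlam1 k]
  have hprob : ∀ k, IsProbabilityMeasure (pastLaw p (lam k)) := fun k =>
    isProbabilityMeasure_pastLaw p (hlam0 k)
  -- The number of points kept depends on the rate: it must beat the factor exponential in `lam k`
  -- in the characteristic function error, uniformly in the frequency.
  have hn : ∀ k, ∃ n, (1 + Real.exp (lam k * (2 * (u + v + 1))))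
      * (pastLaw p (lam k)).real {ω | elapsed ω n < u + v + 1} ≤ 1 / lam k := by
    intro k
    have h := (tendsto_measureReal_elapsed_lt (μ := p.toMeasure) (hlam0 k)
      (u + v + 1)).const_mul (1 + Real.exp (lam k * (2 * (u + v + 1))))
    rw [mul_zero] at h
    exact (h.eventually_le_const (one_div_pos.2 (hlam0 k))).exists
  choose n hn using hn
  set q : ℕ → ℝ := fun k => (pastLaw p (lam k)).real {ω | elapsed ω (n k) < u + v + 1} with hq
  have hδ : Tendsto (fun k => 1 / lam k) atTop (𝓝 0) := hlam.const_div_atTop 1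
  have hqlim : Tendsto q atTop (𝓝 0) := by
    refine squeeze_zero (fun k => measureReal_nonneg) (fun k => ?_) hδ
    exact (le_mul_of_one_le_left measureReal_nonneg
      (le_add_of_nonneg_right (Real.exp_pos _).le)).trans (hn k)
  have hρ : Tendsto (fun k => e * lam k) atTop atTop := hlam.const_mul_atTop (by linarith)
  have hnormal : ∀ ε : ℕ → ℝ, Tendsto (fun k => ε k / √(e * lam k)) atTop (𝓝 0) →
      Tendsto (fun k => (pastLaw p (lam k)).real
        {ω | e * lam k - ε k ≤ pointSum (meets i i) (n k) ω}) atTop (𝓝 (1 / 2)) := fun ε hε =>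
    tendsto_measureReal_sub_le (fun k => measurable_pointSum (measurable_meets i i) (n k)) hρ hε hδ
      fun k s => (norm_integral_cexp_pointSum_meets_sub_le hp (hlam0 k) (n k) s).trans (hn k)
  have hy : Tendsto (fun k => √(√(lam k))) atTop atTop :=
    Real.tendsto_sqrt_atTop.comp (Real.tendsto_sqrt_atTop.comp hlam)
  refine ⟨?_, fun d hd => ?_⟩
  -- The slack `x = lam ^ (1/4)`: small against `√(e * lam)`, yet large enough for `exp (-c x)` to
  -- absorb the number of windows, of order `x ^ 4`.
  · have hε : Tendsto (fun k => √(√(lam k)) / √(e * lam k)) atTop (𝓝 0) := by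
      refine squeeze_zero (fun k => by positivity) (fun k => ?_) (hy.const_div_atTop 1)
      have hw : 0 < √(√(lam k)) := Real.sqrt_pos.2 (Real.sqrt_pos.2 (hlam0 k))
      have h1 : √(lam k) ≤ √(e * lam k) :=
        Real.sqrt_le_sqrt (le_mul_of_one_le_left (hlam0 k).le he1)
      rw [div_le_div_iff₀ ((Real.sqrt_pos.2 (hlam0 k)).trans_le h1) hw, one_mul,
        Real.mul_self_sqrt (Real.sqrt_nonneg _)]
      exact h1
    have hlow := (hnormal 0 (by simp)).sub hqlim
    have hexp := (tendsto_pow_add_one_mul_exp 4 s 3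
      (c := (reservationPMF p i).toReal / (4 * s)) (by positivity)).comp hy
    have hup := (hqlim.add (hnormal _ hε)).add hexp
    rw [sub_zero] at hlow
    rw [zero_add, add_zero] at hup
    refine tendsto_of_tendsto_of_tendsto_of_le_of_le hlow hup (fun k => ?_) fun k => ?_
    · have h := le_virtualBlockingProb hp (hlam0 k) (n k) s (e * lam k)
      simp only [Pi.zero_apply, sub_zero]
      exact sub_le_iff_le_add.2 h
    · have h := virtualBlockingProb_le_of_eq hp (hlam1 k) (n k) hs (e * lam k) (√(√(lam k)))
      have h4 : √(√(lam k)) ^ 4 = lam k := by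
        rw [show 4 = 2 * 2 from rfl, pow_mul, Real.sq_sqrt (Real.sqrt_nonneg _),
          Real.sq_sqrt (hlam0 k).le]
      simp only [Function.comp_apply, h4]
      exact h
  · have hexp := (tendsto_pow_add_one_mul_exp 1 s 2
      (c := (reservationPMF p i).toReal ^ 2 / (4 * v)) (by positivity)).comp hlam
    have hup := hqlim.add hexp
    rw [add_zero] at hup
    refine squeeze_zero (fun k => measureReal_nonneg) (fun k => ?_) hup
    have h := virtualBlockingProb_le_of_lt hp (hlam1 k) (n k) (s := s) hd
    simp only [Function.comp_apply, pow_one]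
    exact h

end

end AdvanceReservation

end

theorem proposition3 (u v : ℕ) (p : PMF (ℕ × ℕ))
    (hD : ∀ d, AdvanceReservation.reservationPMF p d ≠ 0 → d ≤ u)
    (hS : ∀ s, AdvanceReservation.servicePMF p s ≠ 0 → 1 ≤ s ∧ s ≤ v)
    (i : ℕ) (hi : IsLeast {d : ℕ | 0 < AdvanceReservation.reservationPMF p d} i) :
    ∀ s : ℕ, 1 ≤ s → s ≤ v →
      Tendsto (fun lam : ℝ => AdvanceReservation.virtualBlockingProb p lam
          (AdvanceReservation.trafficIntensity p v lam) i s) atTop (𝓝 (1 / 2)) ∧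
      ∀ d : ℕ, i + 1 ≤ d → d ≤ u →
        Tendsto (fun lam : ℝ => AdvanceReservation.virtualBlockingProb p lam
          (AdvanceReservation.trafficIntensity p v lam) d s) atTop (𝓝 0) := by
  intro s hs _
  have hp := AdvanceReservation.ae_isRequest hD hS hi
  have hγ : 0 < (AdvanceReservation.reservationPMF p i).toReal :=
    ENNReal.toReal_pos hi.1.ne' (PMF.apply_ne_top _ _)
  simp only [AdvanceReservation.trafficIntensity_eq hp hS]
  -- The estimates need rates at least `1`; replacing `x` by `max x 1` changes only finitely many
  -- terms.
  have hseq : ∀ x : ℕ → ℝ, Tendsto x atTop atTop →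
      ∃ y : ℕ → ℝ, (∀ k, 1 ≤ y k) ∧ Tendsto y atTop atTop ∧ y =ᶠ[atTop] x := by
    intro x hx
    refine ⟨fun k => max (x k) 1, fun k => le_max_right _ _,
      tendsto_atTop_mono (fun k => le_max_left _ _) hx, ?_⟩
    filter_upwards [hx.eventually_ge_atTop 1] with k hk using max_eq_left hk
  refine ⟨tendsto_iff_seq_tendsto.2 fun x hx => ?_,
    fun d hd _ => tendsto_iff_seq_tendsto.2 fun x hx => ?_⟩
  · obtain ⟨y, hy1, hy, hyx⟩ := hseq x hx
    refine (AdvanceReservation.tendsto_virtualBlockingProb_seq hp hγ hy1 hy hs).1.congr' ?_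
    filter_upwards [hyx] with k hk
    rw [Function.comp_apply, hk]
  · obtain ⟨y, hy1, hy, hyx⟩ := hseq x hx
    refine ((AdvanceReservation.tendsto_virtualBlockingProb_seq hp hγ hy1 hy hs).2 d hd).congr' ?_
    filter_upwards [hyx] with k hk
    rw [Function.comp_apply, hk]
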